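/- Let $\xi_1,\xi_2,\dots$ be independent standard Gaussian random variables, let $\sigma_j>0$ ($j\ge 1$) be known constants, and for $\epsilon>0$ suppose that one observes $y=\{y_j\}_{j=1}^\infty$, $$y_j = x_j+\epsilon\,\sigma_j\,\xi_j,\qquad j=1,2,\dots,$$ with an unknown sequence $x=\{x_j\}_{j=1}^\infty$. For $\alpha>0$ and $P_0>0$ let $$B(\alpha,P_0)=\Bigl\{x=\{x_j\}_{j=1}^\infty:\ \sup_{k\ge1} k^{2\alpha}\sum_{j=k}^\infty x_j^2\le P_0\Bigr\},$$ and let $\|x\|^2=\sum_{j=1}^\infty x_j^2$. Assume (A1) there is $c>0$ such that $c<\sigma_j^2<\infty$ for all $j\ge 1$; (B1) there is $j_0\ge1$ such that $\dfrac{\sigma_j^2\,j^{2\alpha+1}}{\sigma_{j-1}^2\,(j-1)^{2\alpha+1}}>1$ for all $j>j_0$. Let $\hat x_{\epsilon}=\{\lambda_j y_j\}_{j=1}^\infty$ be the linear estimator with $$\lambda_j=\frac{2\alpha P_0\,j^{-2\alpha-1}}{2\alpha P_0\,j^{-2\alpha-1}+\epsilon^2\sigma_j^2},\qquad j\ge1.$$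 Then $\hat x_\epsilon$ is asymptotically minimax on $B(\alpha,P_0)$ among all estimators: as $\epsilon\to0$, $$R_\epsilon:=\sup_{x\in B(\alpha,P_0)}E_x\|\hat x_\epsilon-x\|^2=(1+o(1))\,\inf_{\tilde x_\epsilon}\ \sup_{x\in B(\alpha,P_0)}E_x\|\tilde x_\epsilon-x\|^2,$$ where the infimum is over all estimators $\tilde x_\epsilon$ (all measurable functions of $y$ with values in the space of real sequences). Moreover, both $R_\epsilon$ and the minimax risk (the infimum above) are equal to $$(1+o(1))\;\epsilon^2\sum_{j=1}^\infty\frac{2\alpha P_0\,j^{-2\alpha-1}\,\sigma_j^2}{2\alpha P_0\,j^{-2\alpha-1}+\epsilon^2\sigma_j^2}\qquad(\epsilon\to0).$$ -/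

import Mathlib

open MeasureTheory ProbabilityTheory Filter Topology
open scoped ENNReal

/-! Sequences `x₁, x₂, …` are represented by functions `ℕ → ℝ`; the entry with index
`j : ℕ` is the coordinate number `j + 1`. -/

namespace SeqModel

noncomputable section

/-- The law of the noise `ξ`: independent standard Gaussian coordinates. -/
def noise : Measure (ℕ → ℝ) :=
  Measure.infinitePi fun _ : ℕ => gaussianReal 0 1

/-- The observation `y_j = x_j + ε σ_j ξ_j`. -/
def observation (σ : ℕ → ℝ) (ε : ℝ) (x ξ : ℕ → ℝ) : ℕ → ℝ :=
  fun j => x j + ε * σ j * ξ j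

/-- The squared `ℓ²` distance, with value `∞` if the difference is not square summable. -/
def loss (u x : ℕ → ℝ) : ℝ≥0∞ :=
  ∑' j, ENNReal.ofReal ((u j - x j) ^ 2)

/-- The risk `E_x ‖x̂(y) - x‖²` of the estimator `est` at `x`. -/
def risk (σ : ℕ → ℝ) (ε : ℝ) (est : (ℕ → ℝ) → (ℕ → ℝ)) (x : ℕ → ℝ) : ℝ≥0∞ :=
  ∫⁻ ξ, loss (est (observation σ ε x ξ)) x ∂noise

/-- The maximal risk of an estimator over the set `B`. -/
def maxRisk (σ : ℕ → ℝ) (ε : ℝ) (B : Set (ℕ → ℝ)) (est : (ℕ → ℝ) → (ℕ → ℝ)) : ℝ≥0∞ :=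
  ⨆ x ∈ B, risk σ ε est x

/-- The minimax risk over `B`: the infimum of the maximal risk over all estimators, that is,
over all measurable functions of the observed sequence. -/
def minimaxRisk (σ : ℕ → ℝ) (ε : ℝ) (B : Set (ℕ → ℝ)) : ℝ≥0∞ :=
  ⨅ (est : (ℕ → ℝ) → (ℕ → ℝ)) (_ : Measurable est), maxRisk σ ε B est

/-- The family of estimators `est ε`, `ε > 0`, is asymptotically minimax on `B` if its maximal
risk is `(1 + o(1))` times the minimax risk as `ε → 0`. In `ℝ≥0∞` a quotient that tends to `1`
eventually has a numerator and a denominator that are positive and finite. -/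
def IsAsymptoticallyMinimax (σ : ℕ → ℝ) (B : Set (ℕ → ℝ))
    (est : ℝ → (ℕ → ℝ) → (ℕ → ℝ)) : Prop :=
  (∀ ε, 0 < ε → Measurable (est ε)) ∧
    Tendsto (fun ε : ℝ => maxRisk σ ε B (est ε) / minimaxRisk σ ε B) (𝓝[>] 0) (𝓝 1)

/-- The linear estimator `x̂_j = λ_j y_j`. -/
def linearEstimator (lam : ℕ → ℝ) (y : ℕ → ℝ) : ℕ → ℝ :=
  fun j => lam j * y j

/-- The set `B(a, P₀)` of all square summable `x` with
`a_k⁻¹ ∑_{j ≥ k} x_j² ≤ P₀` for all `k`. -/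
def tailBall (a : ℕ → ℝ) (P₀ : ℝ) : Set (ℕ → ℝ) :=
  {x | Summable (fun j => x j ^ 2) ∧ ∀ k, (a k)⁻¹ * ∑' j, x (k + j) ^ 2 ≤ P₀}

/-- The set `B(α, P₀)`, where the `k`-th entry of `a` is `k ^ (-2α)`, `k = 1, 2, …`. -/
def besovBall (α P₀ : ℝ) : Set (ℕ → ℝ) :=
  tailBall (fun k => ((k : ℝ) + 1) ^ (-2 * α)) P₀

/-- The sequence `2 α P₀ j ^ (-2α - 1)`, `j = 1, 2, …`. -/
def thetaSq (α P₀ : ℝ) (j : ℕ) : ℝ :=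
  2 * α * P₀ * ((j : ℝ) + 1) ^ (-2 * α - 1)

/-- The weights `λ_j = 2αP₀ j^(-2α-1) / (2αP₀ j^(-2α-1) + ε² σ_j²)`. -/
def weight (α P₀ : ℝ) (σ : ℕ → ℝ) (ε : ℝ) (j : ℕ) : ℝ :=
  thetaSq α P₀ j / (thetaSq α P₀ j + ε ^ 2 * σ j ^ 2)

/-- The quantity `ε² ∑_j 2αP₀ j^(-2α-1) σ_j² / (2αP₀ j^(-2α-1) + ε² σ_j²)`. -/
def riskSum (α P₀ : ℝ) (σ : ℕ → ℝ) (ε : ℝ) : ℝ≥0∞ :=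
  ENNReal.ofReal (ε ^ 2) *
    ∑' j, ENNReal.ofReal (thetaSq α P₀ j * σ j ^ 2 / (thetaSq α P₀ j + ε ^ 2 * σ j ^ 2))

end

end SeqModel

/-! Write θ_j for `thetaSq`. The theorem follows from an upper bound for the linear estimator and a
Bayes lower bound for all estimators, both equal to `riskSum` up to a factor 1 + o(1).

Upper bound (`maxRisk_linearEstimator_le`). The risk at x is ∑ (1 - λ_j)² x_j² + ∑ λ_j² ε² σ_j², and
substituting θ_j for x_j² gives exactly `riskSum`. By (B1) the weights (1 - λ_j)² increase from some
index on. Convexity of the power function shows that the tails of θ dominate the allowed tails of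
x², so summation by parts bounds the bias by its value at θ (`tsum_ofReal_mul_sq_le`). The finitely
many earlier coordinates contribute O(ε⁴), whereas `riskSum` is at least of order ε².

Lower bound (`mul_riskSum_le_maxRisk_add`). Let J be the crossover index where ε² σ_j² overtakes a
small multiple of θ_j (`exists_crossover`); it tends to infinity as ε → 0. The prior has independent
coordinates. From J on they are Gaussian with variance (1 - 2δ) θ_j. Below J the noise is so small
that a truncated Gaussian using only a fraction τ of the energy θ_j already forces a risk close to
ε² σ_j². By the strong law of large numbers, the prior lies in the ball except on an event of small
probability (`tendsto_measure_tailEvent_compl`). On that event the tail loss is controlled by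
cutting the estimator off (`cutTail`). What remains is a small multiple of the tail bound at J,
hence of `riskSum`, since past the crossover each risk term is comparable with θ_j. -/

namespace SeqModel

/-! ### Gaussian moments and scalar Bayes risks. -/

lemma integrable_pow_gaussianReal (n : ℕ) :
    Integrable (fun t : ℝ => t ^ n) (gaussianReal 0 1) := by
  have h := (memLp_id_gaussianReal (μ := 0) (v := 1) n).integrable_norm_pow'
  refine (integrable_norm_iff (by fun_prop)).1 ?_
  simpa [norm_pow] using h

lemma integral_sq_gaussianReal : ∫ t : ℝ, t ^ 2 ∂gaussianReal 0 1 = 1 := by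
  have h := variance_fun_id_gaussianReal (μ := 0) (v := 1)
  rw [variance_of_integral_eq_zero (by fun_prop) (by simp)] at h
  simpa using h

lemma integral_affine_sq_gaussianReal (a b : ℝ) :
    ∫ t : ℝ, (a + b * t) ^ 2 ∂gaussianReal 0 1 = a ^ 2 + b ^ 2 := by
  have h1 : Integrable (fun t : ℝ => t) (gaussianReal 0 1) := by
    simpa using integrable_pow_gaussianReal 1
  have h2 := integrable_pow_gaussianReal 2
  have : ∀ t : ℝ, (a + b * t) ^ 2 = a ^ 2 + (2 * a * b * t + b ^ 2 * t ^ 2) := fun t => by ring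
  simp_rw [this]
  have h3 : Integrable (fun t : ℝ => 2 * a * b * t + b ^ 2 * t ^ 2) (gaussianReal 0 1) :=
    (h1.const_mul _).add (h2.const_mul _)
  rw [integral_add (integrable_const _) h3,
    integral_add (h1.const_mul _) (h2.const_mul _), integral_const_mul, integral_const_mul,
    integral_sq_gaussianReal]
  simp

lemma lintegral_affine_sq_gaussianReal (a b : ℝ) :
    ∫⁻ t : ℝ, ENNReal.ofReal ((a + b * t) ^ 2) ∂gaussianReal 0 1 =
      ENNReal.ofReal (a ^ 2 + b ^ 2) := by
  rw [← integral_affine_sq_gaussianReal, ofReal_integral_eq_lintegral_ofReal]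
  · have h1 : Integrable (fun t : ℝ => t) (gaussianReal 0 1) := by
      simpa using integrable_pow_gaussianReal 1
    have h2 := integrable_pow_gaussianReal 2
    have : ∀ t : ℝ, (a + b * t) ^ 2 = a ^ 2 + (2 * a * b * t + b ^ 2 * t ^ 2) := fun t => by ring
    simp_rw [this]
    exact (integrable_const _).add ((h1.const_mul _).add (h2.const_mul _))
  · exact ae_of_all _ fun t => sq_nonneg _

/-- The fourth moment of the standard Gaussian law. -/
noncomputable def fourthMoment : ℝ := ∫ t : ℝ, t ^ 4 ∂gaussianReal 0 1

lemma fourthMoment_nonneg : 0 ≤ fourthMoment :=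
  integral_nonneg fun t => by positivity

lemma lintegral_pow_four_gaussianReal {c : ℝ} (hc : 0 ≤ c) :
    ∫⁻ t : ℝ, ENNReal.ofReal (c * t ^ 4) ∂gaussianReal 0 1 =
      ENNReal.ofReal (c * fourthMoment) := by
  rw [fourthMoment, ← integral_const_mul, ofReal_integral_eq_lintegral_ofReal]
  · exact (integrable_pow_gaussianReal 4).const_mul _
  · exact ae_of_all _ fun t => by positivity

/-- The Bayes risk for a Gaussian prior in the scalar Gaussian model. -/
lemma gaussian_bayes_le {a d : ℝ} (ha : 0 < a) (hd : 0 < d) {f : ℝ → ℝ} (hf : Measurable f) :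
    ENNReal.ofReal (a ^ 2 * d ^ 2 / (a ^ 2 + d ^ 2)) ≤
      ∫⁻ t, ∫⁻ s, ENNReal.ofReal ((f (a * t + d * s) - a * t) ^ 2)
        ∂gaussianReal 0 1 ∂gaussianReal 0 1 := by
  set ρ := √(a ^ 2 + d ^ 2) with hρ
  have hpos : 0 < a ^ 2 + d ^ 2 := by positivity
  have hρ0 : 0 < ρ := Real.sqrt_pos.2 hpos
  have hρ2 : ρ ^ 2 = a ^ 2 + d ^ 2 := Real.sq_sqrt hpos.le
  -- Rotate (t, s) so that the first new coordinate u is the normalised observation (a t + d s) / ρ.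
  -- Then a t = (a² / ρ) u - (a d / ρ) w with w independent of u, and no function of u can reduce
  -- the error below the variance a² d² / ρ² of the w part.
  obtain ⟨φ, hc, hs⟩ : ∃ φ : ℝ, Real.cos φ = a / ρ ∧ Real.sin φ = d / ρ := by
    have hdρ : d / ρ ≤ 1 := by
      rw [div_le_one hρ0]
      exact Real.le_sqrt_of_sq_le (by nlinarith)
    refine ⟨Real.arcsin (d / ρ), ?_, Real.sin_arcsin (by linarith [show 0 ≤ d / ρ by positivity]) hdρ⟩
    rw [Real.cos_arcsin, Real.sqrt_eq_iff_mul_self_eq (by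
      have : 0 ≤ d / ρ := by positivity
      nlinarith) (by positivity)]
    field_simp
    nlinarith
  have hrot := IsGaussian.map_rotation_eq_self (μ := gaussianReal 0 1) (by simp) φ
  set F : ℝ × ℝ → ℝ≥0∞ := fun p => ENNReal.ofReal ((f (ρ * p.1) - a * (a / ρ) * p.1 + a * (d / ρ) * p.2) ^ 2)
    with hF
  have hFm : Measurable F := by
    have : Measurable fun p : ℝ × ℝ => f (ρ * p.1) := hf.comp (by fun_prop)
    fun_prop
  calc ENNReal.ofReal (a ^ 2 * d ^ 2 / (a ^ 2 + d ^ 2))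
      = ∫⁻ u : ℝ, ENNReal.ofReal (a ^ 2 * d ^ 2 / (a ^ 2 + d ^ 2)) ∂gaussianReal 0 1 := by simp
    _ ≤ ∫⁻ u, ∫⁻ w, F (u, w) ∂gaussianReal 0 1 ∂gaussianReal 0 1 := by
        refine lintegral_mono fun u => ?_
        simp only [hF]
        rw [lintegral_affine_sq_gaussianReal]
        refine ENNReal.ofReal_le_ofReal ?_
        have : (a * (d / ρ)) ^ 2 = a ^ 2 * d ^ 2 / (a ^ 2 + d ^ 2) := by
          rw [← hρ2]; field_simp
        rw [this]
        nlinarith [sq_nonneg (f (ρ * u) - a * (a / ρ) * u)]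
    _ = ∫⁻ p, F p ∂((gaussianReal 0 1).prod (gaussianReal 0 1)) :=
        (lintegral_prod _ hFm.aemeasurable).symm
    _ = ∫⁻ p, F (ContinuousLinearMap.rotation φ p) ∂((gaussianReal 0 1).prod (gaussianReal 0 1)) := by
        conv_lhs => rw [← hrot]
        rw [lintegral_map hFm (by fun_prop)]
    _ = ∫⁻ t, ∫⁻ s, F (ContinuousLinearMap.rotation φ (t, s))
        ∂gaussianReal 0 1 ∂gaussianReal 0 1 :=
        lintegral_prod _ (hFm.comp (by fun_prop)).aemeasurable
    _ = _ := by
        refine lintegral_congr fun t => lintegral_congr fun s => ?_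
        simp only [hF, ContinuousLinearMap.rotation_apply, hc, hs, smul_eq_mul]
        have e1 : ρ * (a / ρ * t + d / ρ * s) = a * t + d * s := by field_simp
        have e2 : a * (a / ρ) * (a / ρ * t + d / ρ * s) - a * (d / ρ) * (-(d / ρ) * t + a / ρ * s)
            = a * t := by
          field_simp
          linear_combination (-t) * hρ2
        rw [e1, ← e2]
        congr 2
        ring

/-- The multiple `a * t`, set to zero where it exceeds `A` in absolute value. -/
noncomputable def truncMul (a A t : ℝ) : ℝ := if |a * t| ≤ A then a * t else 0

lemma measurable_truncMul (a A : ℝ) : Measurable (truncMul a A) :=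
  Measurable.ite (measurableSet_le (by fun_prop) (by fun_prop)) (by fun_prop) (by fun_prop)

lemma truncMul_sq_le {a A : ℝ} (hA : 0 ≤ A) (t : ℝ) : truncMul a A t ^ 2 ≤ A ^ 2 := by
  unfold truncMul
  split_ifs with h
  · exact sq_le_sq.2 (by rwa [abs_of_nonneg hA])
  · simpa using sq_nonneg A

/-- A lower bound for the Bayes risk when the Gaussian prior is truncated. -/
lemma truncated_bayes_le {a d A : ℝ} (ha : 0 < a) (hd : 0 < d) (hA : 0 < A) {f : ℝ → ℝ}
    (hf : Measurable f) :
    ENNReal.ofReal (a ^ 2 * d ^ 2 / (a ^ 2 + d ^ 2) - 4 * a ^ 4 / A ^ 2 * fourthMoment) ≤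
      ∫⁻ t, ∫⁻ s, ENNReal.ofReal ((f (truncMul a A t + d * s) - truncMul a A t) ^ 2)
        ∂gaussianReal 0 1 ∂gaussianReal 0 1 := by
  have hc : 0 ≤ 4 * a ^ 4 / A ^ 2 := by positivity
  rw [ENNReal.ofReal_sub _ (mul_nonneg hc fourthMoment_nonneg), tsub_le_iff_right]
  -- Where |a t| ≤ A, clamping to [-A, A] can only reduce the error, so the untruncated bound may be
  -- applied to `g`. Where |a t| > A, the loss of `g` is at most 4 (a t)² ≤ 4 a⁴ t⁴ / A², which
  -- integrates to the subtracted term.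
  set g : ℝ → ℝ := fun y => max (-A) (min A (f y)) with hg
  have hgm : Measurable g := by fun_prop
  have hgA : ∀ y, |g y| ≤ A := fun y => abs_le.2 ⟨le_max_left _ _, max_le (by linarith) (min_le_left _ _)⟩
  refine (gaussian_bayes_le ha hd hgm).trans ?_
  rw [← lintegral_pow_four_gaussianReal hc, ← lintegral_add_right _ (by fun_prop)]
  refine lintegral_mono fun t => ?_
  by_cases h : |a * t| ≤ A
  · refine le_add_right (lintegral_mono fun s => ENNReal.ofReal_le_ofReal ?_)
    simp only [truncMul, if_pos h]
    refine sq_le_sq.2 ?_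
    obtain ⟨h1, h2⟩ := abs_le.1 h
    have e : a * t = max (-A) (min A (a * t)) := by rw [min_eq_right h2, max_eq_right h1]
    calc |g (a * t + d * s) - a * t|
        = |max (-A) (min A (f (a * t + d * s))) - max (-A) (min A (a * t))| := by rw [← e]
      _ ≤ _ := (abs_max_sub_max_le_max _ _ _ _).trans (by
      rw [sub_self, abs_zero, max_eq_right (abs_nonneg _)]
      exact (abs_min_sub_min_le_max _ _ _ _).trans (by simp))
  · refine le_add_left ?_
    refine (lintegral_mono fun s => ENNReal.ofReal_le_ofReal
      (show _ ≤ 4 * a ^ 4 / A ^ 2 * t ^ 4 from ?_)).trans (by simp)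
    have h' := (not_le.1 h).le
    have h1 : (g (a * t + d * s) - a * t) ^ 2 ≤ 4 * |a * t| ^ 2 := by
      have := hgA (a * t + d * s)
      have h3 : |g (a * t + d * s) - a * t| ≤ 2 * |a * t| :=
        (abs_sub _ _).trans (by linarith)
      rw [← sq_abs]
      nlinarith [abs_nonneg (g (a * t + d * s) - a * t)]
    refine h1.trans ?_
    have h2 : A ^ 2 ≤ |a * t| ^ 2 := by gcongr
    rw [sq_abs] at h2 ⊢
    rw [div_mul_eq_mul_div, le_div_iff₀ (by positivity)]
    nlinarith [mul_le_mul_of_nonneg_left h2 (show 0 ≤ 4 * (a * t) ^ 2 by positivity)]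

/-! ### Resampling one coordinate of the noise. -/

instance : IsProbabilityMeasure noise := by unfold noise; infer_instance

lemma measurable_update_prod (j : ℕ) :
    Measurable fun p : (ℕ → ℝ) × ℝ => Function.update p.1 j p.2 := by
  refine measurable_pi_lambda _ fun i => ?_
  by_cases h : i = j
  · subst h; simpa using measurable_snd
  · simp only [Function.update_of_ne h]; fun_prop

/-- A box pulls back to a box without its j-th factor times that factor, and boxes determine the
product law. This permits conditioning on all other coordinates without splitting the index set. -/
lemma map_update_noise (j : ℕ) :
    (noise.prod (gaussianReal 0 1)).map (fun p => Function.update p.1 j p.2) = noise := by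
  have hm := measurable_update_prod j
  unfold noise
  refine Measure.eq_infinitePi _ fun s t ht => ?_
  rw [Measure.map_apply hm (MeasurableSet.pi s.countable_toSet fun i _ => ht i)]
  have : (fun p : (ℕ → ℝ) × ℝ => Function.update p.1 j p.2) ⁻¹' (s : Set ℕ).pi t =
      ((s.erase j : Finset ℕ) : Set ℕ).pi t ×ˢ (if j ∈ s then t j else Set.univ) := by
    ext ⟨x, y⟩
    simp only [Set.mem_preimage, Set.mem_pi, Finset.mem_coe, Set.mem_prod, Finset.mem_erase]
    constructor
    · intro h
      refine ⟨fun i hi => by simpa [hi.1] using h i hi.2, ?_⟩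
      split_ifs with hj
      · simpa using h j hj
      · trivial
    · rintro ⟨h1, h2⟩ i hi
      by_cases hij : i = j
      · subst hij; simpa [hi] using h2
      · simpa [hij] using h1 i ⟨hij, hi⟩
  rw [this, Measure.prod_prod, Measure.infinitePi_pi _ fun i _ => ht i]
  split_ifs with hj
  · exact Finset.prod_erase_mul _ _ hj
  · simp [Finset.erase_eq_of_notMem hj]

/-- Resampling one coordinate does not change the law of the noise. -/
lemma lintegral_noise_update (j : ℕ) {F : (ℕ → ℝ) → ℝ≥0∞} (hF : Measurable F) :
    ∫⁻ ξ, F ξ ∂noise = ∫⁻ ξ, ∫⁻ t, F (Function.update ξ j t) ∂gaussianReal 0 1 ∂noise := by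
  conv_lhs => rw [← map_update_noise j]
  rw [lintegral_map hF (measurable_update_prod j),
    lintegral_prod (fun p : (ℕ → ℝ) × ℝ => F (Function.update p.1 j p.2))
      (hF.comp (measurable_update_prod j)).aemeasurable]

lemma lintegral_noise_coord (j : ℕ) {F : ℝ → ℝ≥0∞} (hF : Measurable F) :
    ∫⁻ ξ, F (ξ j) ∂noise = ∫⁻ t, F t ∂gaussianReal 0 1 := by
  rw [lintegral_noise_update j (F := fun ξ => F (ξ j)) (hF.comp (measurable_pi_apply j))]
  simp

/-- A lower bound for a double integral by means of a pair of coordinates. -/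
lemma lintegral_le_lintegral_noise_noise (j : ℕ) {F : (ℕ → ℝ) → (ℕ → ℝ) → ℝ≥0∞}
    (hF : Measurable (Function.uncurry F)) {G : (ℕ → ℝ) → ℝ≥0∞}
    (h : ∀ ζ ξ, G ζ ≤ ∫⁻ t, ∫⁻ s, F (Function.update ζ j t) (Function.update ξ j s)
      ∂gaussianReal 0 1 ∂gaussianReal 0 1) :
    ∫⁻ ζ, G ζ ∂noise ≤ ∫⁻ ζ, ∫⁻ ξ, F ζ ξ ∂noise ∂noise := by
  have hF1 : Measurable fun ζ => ∫⁻ ξ, F ζ ξ ∂noise := hF.lintegral_prod_right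
  rw [lintegral_noise_update j hF1]
  refine lintegral_mono fun ζ => ?_
  calc G ζ = ∫⁻ _, G ζ ∂noise := by simp
    _ ≤ ∫⁻ ξ, ∫⁻ t, ∫⁻ s, F (Function.update ζ j t) (Function.update ξ j s)
      ∂gaussianReal 0 1 ∂gaussianReal 0 1 ∂noise := lintegral_mono fun ξ => h ζ ξ
    _ = ∫⁻ t, ∫⁻ ξ, ∫⁻ s, F (Function.update ζ j t) (Function.update ξ j s)
      ∂gaussianReal 0 1 ∂noise ∂gaussianReal 0 1 := by
        refine lintegral_lintegral_swap (Measurable.aemeasurable ?_)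
        refine Measurable.lintegral_prod_right' (f := fun q : ((ℕ → ℝ) × ℝ) × ℝ =>
          F (Function.update ζ j q.1.2) (Function.update q.1.1 j q.2)) ?_
        exact hF.comp (((measurable_update_prod j).comp
          (measurable_const.prodMk (measurable_snd.comp measurable_fst))).prodMk
          ((measurable_update_prod j).comp
            ((measurable_fst.comp measurable_fst).prodMk measurable_snd)))
    _ = _ := by
        refine lintegral_congr fun t => ?_
        exact (lintegral_noise_update j (hF.comp measurable_prodMk_left)).symm

/-! ### Comparison of the extremal sequence with the tail bounds. -/

/-- The bound `P₀ k ^ (-2α)` on the tail sums over `besovBall α P₀`. -/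
noncomputable def tailBound (α P₀ : ℝ) (k : ℕ) : ℝ := P₀ * ((k : ℝ) + 1) ^ (-2 * α)

/-- Convexity: the graph lies above its tangent. Since `thetaSq` is minus the derivative of
`tailBound` in the index, tangents at neighbouring integers sandwich the increments of `tailBound`
between consecutive values of `thetaSq`. -/
lemma rpow_tangent_le {p u w : ℝ} (hp : p ≤ 0) (hu : 0 < u) (hw : 0 < w) :
    u ^ p + p * u ^ (p - 1) * (w - u) ≤ w ^ p := by
  have hx : 0 < w / u := by positivity
  have h1 : 1 + p * (w / u - 1) ≤ (w / u) ^ p := by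
    rw [Real.rpow_def_of_pos hx]
    have h2 := Real.add_one_le_exp (Real.log (w / u) * p)
    have h3 := Real.log_le_sub_one_of_pos hx
    nlinarith
  rw [Real.div_rpow hw.le hu.le, le_div_iff₀ (by positivity)] at h1
  refine le_trans (le_of_eq ?_) h1
  rw [Real.rpow_sub_one hu.ne']
  field_simp

section

variable {α P₀ : ℝ}

lemma thetaSq_pos (hα : 0 < α) (hP₀ : 0 < P₀) (j : ℕ) : 0 < thetaSq α P₀ j := by
  unfold thetaSq; positivity

lemma tailBound_pos (hP₀ : 0 < P₀) (k : ℕ) : 0 < tailBound α P₀ k := by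
  unfold tailBound; positivity

lemma thetaSq_mul_succ (j : ℕ) :
    thetaSq α P₀ j * ((j : ℝ) + 1) = 2 * α * tailBound α P₀ j := by
  have : (0 : ℝ) < (j : ℝ) + 1 := by positivity
  unfold thetaSq tailBound
  rw [Real.rpow_sub_one this.ne']
  field_simp

lemma tailBound_sub_succ_le_thetaSq (hα : 0 < α) (hP₀ : 0 < P₀) (k : ℕ) :
    tailBound α P₀ k - tailBound α P₀ (k + 1) ≤ thetaSq α P₀ k := by
  have h := rpow_tangent_le (p := -2 * α) (u := (k : ℝ) + 1) (w := (k : ℝ) + 2) (by linarith)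
    (by positivity) (by positivity)
  unfold tailBound thetaSq
  push_cast
  have e : (k : ℝ) + 1 + 1 = k + 2 := by ring
  rw [e]
  nlinarith

lemma thetaSq_succ_le_tailBound_sub (hα : 0 < α) (hP₀ : 0 < P₀) (k : ℕ) :
    thetaSq α P₀ (k + 1) ≤ tailBound α P₀ k - tailBound α P₀ (k + 1) := by
  have h := rpow_tangent_le (p := -2 * α) (u := (k : ℝ) + 2) (w := (k : ℝ) + 1) (by linarith)
    (by positivity) (by positivity)
  unfold tailBound thetaSq
  push_cast
  have e : (k : ℝ) + 1 + 1 = k + 2 := by ring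
  rw [e]
  nlinarith

lemma tailBound_antitone (hα : 0 < α) (hP₀ : 0 < P₀) : Antitone (tailBound α P₀) :=
  antitone_nat_of_succ_le fun k => by
    have h1 := thetaSq_succ_le_tailBound_sub hα hP₀ k
    have h2 := thetaSq_pos hα hP₀ (k + 1)
    linarith

lemma thetaSq_antitone (hα : 0 < α) (hP₀ : 0 < P₀) : Antitone (thetaSq α P₀) := by
  intro i j hij
  unfold thetaSq
  have : (i : ℝ) ≤ j := by exact_mod_cast hij
  have := Real.rpow_le_rpow_of_nonpos (x := (i : ℝ) + 1) (y := (j : ℝ) + 1) (z := -2 * α - 1)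
    (by positivity) (by linarith) (by linarith)
  gcongr

lemma thetaSq_le_tailBound (hα : 0 < α) (hP₀ : 0 < P₀) (k : ℕ) :
    thetaSq α P₀ k ≤ 2 * α * tailBound α P₀ k := by
  rw [← thetaSq_mul_succ]
  have := thetaSq_pos hα hP₀ k
  have : (0 : ℝ) ≤ k := by positivity
  nlinarith

lemma tendsto_tailBound (hα : 0 < α) : Tendsto (tailBound α P₀) atTop (𝓝 0) := by
  have h1 : Tendsto (fun k : ℕ => (k : ℝ) + 1) atTop atTop :=
    tendsto_atTop_add_const_right _ _ tendsto_natCast_atTop_atTop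
  have h2 := (tendsto_rpow_neg_atTop (y := 2 * α) (by linarith)).comp h1
  have h3 := h2.const_mul P₀
  simp only [mul_zero] at h3
  refine h3.congr fun k => ?_
  simp [tailBound]

lemma sum_thetaSq_le (hα : 0 < α) (hP₀ : 0 < P₀) (k n : ℕ) :
    ∑ i ∈ Finset.range n, thetaSq α P₀ (k + i) ≤ thetaSq α P₀ k + tailBound α P₀ k := by
  have h : ∀ n, ∑ i ∈ Finset.range (n + 1), thetaSq α P₀ (k + i) ≤
      thetaSq α P₀ k + tailBound α P₀ k - tailBound α P₀ (k + n) := by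
    intro n
    induction n with
    | zero => simp
    | succ n ih =>
      rw [Finset.sum_range_succ]
      have := thetaSq_succ_le_tailBound_sub hα hP₀ (k + n)
      rw [← add_assoc]
      linarith
  have h1 := h n
  have h2 := tailBound_pos (α := α) hP₀ (k + n)
  have h3 := thetaSq_pos hα hP₀ (k + n)
  rw [Finset.sum_range_succ] at h1
  linarith

lemma sum_thetaSq_le_mul (hα : 0 < α) (hP₀ : 0 < P₀) (k n : ℕ) :
    ∑ i ∈ Finset.range n, thetaSq α P₀ (k + i) ≤ (1 + 2 * α) * tailBound α P₀ k := by
  have h1 := sum_thetaSq_le hα hP₀ k n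
  have h2 := thetaSq_le_tailBound hα hP₀ k
  linarith

lemma tsum_ofReal_thetaSq_le (hα : 0 < α) (hP₀ : 0 < P₀) (k : ℕ) :
    ∑' i, ENNReal.ofReal (thetaSq α P₀ (k + i)) ≤
      ENNReal.ofReal ((1 + 2 * α) * tailBound α P₀ k) := by
  refine ENNReal.tsum_le_of_sum_range_le fun n => ?_
  rw [← ENNReal.ofReal_sum_of_nonneg fun i _ => (thetaSq_pos hα hP₀ _).le]
  exact ENNReal.ofReal_le_ofReal (sum_thetaSq_le_mul hα hP₀ k n)

lemma tailBound_le_tsum_ofReal (hα : 0 < α) (hP₀ : 0 < P₀) (k : ℕ) :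
    ENNReal.ofReal (tailBound α P₀ k) ≤ ∑' i, ENNReal.ofReal (thetaSq α P₀ (k + i)) := by
  have h : ∀ n, tailBound α P₀ k - tailBound α P₀ (k + n) ≤
      ∑ i ∈ Finset.range n, thetaSq α P₀ (k + i) := by
    intro n
    induction n with
    | zero => simp
    | succ n ih =>
      rw [Finset.sum_range_succ]
      have := tailBound_sub_succ_le_thetaSq hα hP₀ (k + n)
      rw [← add_assoc]
      linarith
  have ht : Tendsto (fun n => ENNReal.ofReal (tailBound α P₀ k - tailBound α P₀ (k + n))) atTop
      (𝓝 (ENNReal.ofReal (tailBound α P₀ k - 0))) := by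
    refine ENNReal.tendsto_ofReal (tendsto_const_nhds.sub ?_)
    simp_rw [add_comm k]
    exact (tendsto_add_atTop_iff_nat k).2 (tendsto_tailBound hα)
  rw [sub_zero] at ht
  refine le_of_tendsto' ht fun n => ?_
  refine (ENNReal.ofReal_le_ofReal (h n)).trans ?_
  rw [ENNReal.ofReal_sum_of_nonneg fun i _ => (thetaSq_pos hα hP₀ _).le]
  exact ENNReal.sum_le_tsum _

end

/-! ### The Gaussian prior satisfies the tail constraints with high probability. -/

/-- Summation by parts: dominated partial sums stay dominated under decreasing weights. -/
lemma sum_mul_le_sum_mul_of_antitone {w a b : ℕ → ℝ} (hw : Antitone w) (hw0 : ∀ i, 0 ≤ w i)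
    (hab : ∀ m, ∑ i ∈ Finset.range m, a i ≤ ∑ i ∈ Finset.range m, b i) (n : ℕ) :
    ∑ i ∈ Finset.range n, w i * a i ≤ ∑ i ∈ Finset.range n, w i * b i := by
  have h : ∀ n, ∑ i ∈ Finset.range n, w i * a i +
      w n * (∑ i ∈ Finset.range n, b i - ∑ i ∈ Finset.range n, a i) ≤
      ∑ i ∈ Finset.range n, w i * b i := by
    intro n
    induction n with
    | zero => simp
    | succ n ih =>
      have h1 := mul_le_mul_of_nonneg_right (hw (Nat.le_succ n)) (sub_nonneg.2 (hab (n + 1)))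
      simp only [Finset.sum_range_succ, Nat.succ_eq_add_one] at h1 ⊢
      linarith
  have h1 := h n
  have h2 := mul_nonneg (hw0 n) (sub_nonneg.2 (hab n))
  linarith

/-- Weighted tails of a nonnegative sequence with averages tending to one. -/
lemma eventually_sum_thetaSq_mul_le {α P₀ δ : ℝ} (hα : 0 < α) (hP₀ : 0 < P₀) (hδ : 0 < δ)
    (hδ' : δ < 1 / 2) {a : ℕ → ℝ}
    (ha : Tendsto (fun n : ℕ => (∑ i ∈ Finset.range n, a i) / n) atTop (𝓝 1)) :
    ∀ᶠ k in atTop, ∀ n, ∑ i ∈ Finset.range n, (1 - 2 * δ) * thetaSq α P₀ (k + i) * a (k + i) ≤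
      (1 - δ) * tailBound α P₀ k := by
  -- Chosen so that (1 + η)² + 4αη ≤ 1 + (3 + 4α) η = 1 + δ; this is the total of the error terms
  -- collected in `h7`.
  set η := δ / (3 + 4 * α) with hη
  have hη0 : 0 < η := by positivity
  have hηδ : (3 + 4 * α) * η = δ := by rw [hη]; field_simp
  have hη1 : η < 1 := by nlinarith
  have e1 : ∀ᶠ n : ℕ in atTop, |(∑ i ∈ Finset.range n, a i) / n - 1| < η := by
    have := (Metric.tendsto_nhds.1 ha) η hη0
    simpa [Real.dist_eq] using this
  obtain ⟨N, hN⟩ := eventually_atTop.1 e1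
  filter_upwards [eventually_ge_atTop N, eventually_ge_atTop 1,
    eventually_ge_atTop ⌈2 * α / η⌉₊] with k hkN hk1 hkα n
  have hS : ∀ m, N ≤ m → 1 ≤ m → (1 - η) * m ≤ ∑ i ∈ Finset.range m, a i ∧
      ∑ i ∈ Finset.range m, a i ≤ (1 + η) * m := by
    intro m hm hm1
    have hm0 : (0 : ℝ) < m := by exact_mod_cast hm1
    obtain ⟨h1, h2⟩ := abs_lt.1 (hN m hm)
    constructor
    · rw [← le_div_iff₀ hm0]; linarith
    · rw [← div_le_iff₀ hm0]; linarith
  -- A window of length m starting at k has sum at most (1 + η)(k + m) - (1 - η) k = (1 + η) m +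
  -- 2ηk. Putting the excess 2ηk on the first index makes the partial sums of `b` dominate for every
  -- m, short windows included.
  set b : ℕ → ℝ := fun i => (1 + η) + if i = 0 then 2 * η * k else 0 with hb
  have key := sum_mul_le_sum_mul_of_antitone (w := fun i => thetaSq α P₀ (k + i))
    (a := fun i => a (k + i)) (b := b)
    (fun i j hij => thetaSq_antitone hα hP₀ (by omega)) (fun i => (thetaSq_pos hα hP₀ _).le) ?_ n
  · have h1 : ∑ i ∈ Finset.range n, thetaSq α P₀ (k + i) * b i ≤
        (1 + η) * (thetaSq α P₀ k + tailBound α P₀ k) + 2 * η * (k * thetaSq α P₀ k) := by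
      simp only [hb, mul_add, Finset.sum_add_distrib]
      have h2 : ∑ i ∈ Finset.range n, (thetaSq α P₀ (k + i) * if i = 0 then 2 * η * k else 0) ≤
          2 * η * (k * thetaSq α P₀ k) := by
        simp only [mul_ite, mul_zero]
        rw [Finset.sum_ite_eq']
        split_ifs
        · simp only [add_zero]; apply le_of_eq; ring
        · have := thetaSq_pos hα hP₀ k; positivity
      have h3 := mul_le_mul_of_nonneg_left (sum_thetaSq_le hα hP₀ k n) (by positivity : 0 ≤ 1 + η)
      rw [Finset.mul_sum] at h3
      have h4 : ∑ i ∈ Finset.range n, (thetaSq α P₀ (k + i) * 1 + thetaSq α P₀ (k + i) * η) =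
          ∑ i ∈ Finset.range n, (1 + η) * thetaSq α P₀ (k + i) :=
        Finset.sum_congr rfl fun i _ => by ring
      rw [← Finset.sum_add_distrib, h4]
      linarith
    have hΘ := tailBound_pos (α := α) hP₀ k
    have hθ := thetaSq_pos hα hP₀ k
    have hk : 2 * α ≤ η * (k + 1) := by
      have := Nat.ceil_le.1 hkα
      rw [div_le_iff₀ hη0] at this
      linarith
    have hms := thetaSq_mul_succ (α := α) (P₀ := P₀) k
    have h5 : thetaSq α P₀ k ≤ η * tailBound α P₀ k := by
      have hk0 : (0 : ℝ) < (k : ℝ) + 1 := by positivity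
      refine le_of_mul_le_mul_right ?_ hk0
      rw [hms]
      nlinarith
    have h6 : (k : ℝ) * thetaSq α P₀ k ≤ 2 * α * tailBound α P₀ k := by linarith
    have h7 : ∑ i ∈ Finset.range n, thetaSq α P₀ (k + i) * a (k + i) ≤
        (1 + δ) * tailBound α P₀ k := by
      refine (key.trans h1).trans ?_
      rw [← hηδ]
      have h8 := mul_le_mul_of_nonneg_left h5 (by positivity : 0 ≤ 1 + η)
      have h9 := mul_le_mul_of_nonneg_left h6 (by positivity : 0 ≤ 2 * η)
      have h10 : η * η * tailBound α P₀ k ≤ η * tailBound α P₀ k := by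
        have : η * η ≤ η := by nlinarith
        gcongr
      nlinarith
    -- The shrinking factor absorbs the fluctuation: (1 - 2δ)(1 + δ) ≤ 1 - δ.
    have h8 := mul_le_mul_of_nonneg_left h7 (by linarith : 0 ≤ 1 - 2 * δ)
    rw [Finset.mul_sum] at h8
    simp only [← mul_assoc] at h8
    refine h8.trans ?_
    nlinarith [mul_pos (mul_pos hδ hδ) hΘ]
  · intro m
    have h1 : ∑ i ∈ Finset.range m, a (k + i) =
        ∑ i ∈ Finset.range (k + m), a i - ∑ i ∈ Finset.range k, a i := by
      rw [Finset.sum_range_add]; ring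
    rcases Nat.eq_zero_or_pos m with rfl | hm
    · simp
    · have h2 := (hS k hkN hk1).1
      have h3 := (hS (k + m) (by omega) (by omega)).2
      have h4 : ∑ i ∈ Finset.range m, b i = m * (1 + η) + 2 * η * k := by
        simp only [hb, Finset.sum_add_distrib, Finset.sum_ite_eq', Finset.mem_range, if_pos hm,
          Finset.sum_const, Finset.card_range, nsmul_eq_mul]
        ring
      rw [h1, h4]
      push_cast at h3
      linarith

lemma ae_tendsto_average_sq :
    ∀ᵐ ξ : ℕ → ℝ ∂noise,
      Tendsto (fun n : ℕ => (∑ i ∈ Finset.range n, ξ i ^ 2) / (n : ℝ)) atTop (𝓝 1) := by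
  have hmap : ∀ i : ℕ, noise.map (fun ξ : ℕ → ℝ => ξ i) = gaussianReal 0 1 := fun i =>
    Measure.infinitePi_map_eval (fun _ : ℕ => gaussianReal 0 1) i
  have hint : Integrable (fun ξ : ℕ → ℝ => ξ 0 ^ 2) noise := by
    have h := integrable_pow_gaussianReal 2
    rw [← hmap 0] at h
    exact h.comp_measurable (measurable_pi_apply 0)
  have hE : ∫ ξ : ℕ → ℝ, ξ 0 ^ 2 ∂noise = 1 := by
    rw [← integral_sq_gaussianReal, ← hmap 0, integral_map (measurable_pi_apply 0).aemeasurable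
      (by fun_prop)]
  have h := strong_law_ae_real (μ := noise) (fun i (ξ : ℕ → ℝ) => ξ i ^ 2) hint ?_ ?_
  · rw [hE] at h; exact h
  · intro i j hij
    have := iIndepFun_infinitePi (P := fun _ : ℕ => gaussianReal 0 1)
      (X := fun (_ : ℕ) (t : ℝ) => t ^ 2) (fun i => by fun_prop)
    exact this.indepFun hij
  · intro i
    have : IdentDistrib (fun ξ : ℕ → ℝ => ξ i) (fun ξ => ξ 0) noise noise :=
      ⟨(measurable_pi_apply i).aemeasurable, (measurable_pi_apply 0).aemeasurable, by rw [hmap, hmap]⟩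
    exact this.comp (u := fun t : ℝ => t ^ 2) (by fun_prop)

/-- The event that all tails of the Gaussian prior from `J` on satisfy a strict tail bound. -/
def tailEvent (α P₀ δ : ℝ) (J : ℕ) : Set (ℕ → ℝ) :=
  {ζ | ∀ k, J ≤ k → ∑' i, ENNReal.ofReal ((1 - 2 * δ) * thetaSq α P₀ (k + i) * ζ (k + i) ^ 2) ≤
    ENNReal.ofReal ((1 - δ) * tailBound α P₀ k)}

lemma measurableSet_tailEvent (α P₀ δ : ℝ) (J : ℕ) : MeasurableSet (tailEvent α P₀ δ J) := by
  have : tailEvent α P₀ δ J = ⋂ k, ⋂ (_ : J ≤ k), {ζ : ℕ → ℝ |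
      ∑' i, ENNReal.ofReal ((1 - 2 * δ) * thetaSq α P₀ (k + i) * ζ (k + i) ^ 2) ≤
      ENNReal.ofReal ((1 - δ) * tailBound α P₀ k)} := by
    ext; simp [tailEvent]
  rw [this]
  refine MeasurableSet.iInter fun k => MeasurableSet.iInter fun _ =>
    measurableSet_le ?_ measurable_const
  exact Measurable.tsum fun i => by fun_prop

/-- The complements decrease in J, and by the strong law almost every point leaves them eventually;
continuity from above does the rest. -/
lemma tendsto_measure_tailEvent_compl {α P₀ δ : ℝ} (hα : 0 < α) (hP₀ : 0 < P₀) (hδ : 0 < δ)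
    (hδ' : δ < 1 / 2) :
    Tendsto (fun J => noise (tailEvent α P₀ δ J)ᶜ) atTop (𝓝 0) := by
  have hanti : Antitone fun J => (tailEvent α P₀ δ J)ᶜ := fun i j hij =>
    Set.compl_subset_compl.2 fun ζ hζ k hk => hζ k (hij.trans hk)
  have h := tendsto_measure_iInter_atTop (μ := noise)
    (fun J => (measurableSet_tailEvent α P₀ δ J).compl.nullMeasurableSet) hanti
    ⟨0, measure_ne_top _ _⟩
  have h0 : noise (⋂ J, (tailEvent α P₀ δ J)ᶜ) = 0 := by
    have : ∀ᵐ ζ ∂noise, ζ ∉ ⋂ J, (tailEvent α P₀ δ J)ᶜ := by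
      filter_upwards [ae_tendsto_average_sq] with ζ hζ
      obtain ⟨J, hJ⟩ := eventually_atTop.1 (eventually_sum_thetaSq_mul_le hα hP₀ hδ hδ' hζ)
      simp only [Set.mem_iInter, Set.mem_compl_iff, not_forall, not_not]
      refine ⟨J, fun k hk => ENNReal.tsum_le_of_sum_range_le fun n => ?_⟩
      rw [← ENNReal.ofReal_sum_of_nonneg]
      · exact ENNReal.ofReal_le_ofReal (hJ k hk n)
      · intro i _
        have := thetaSq_pos hα hP₀ (k + i)
        have : 0 < 1 - 2 * δ := by linarith
        positivity
    simpa only [ae_iff, not_not, Set.ofPred_mem_eq] using this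
  rwa [h0] at h

/-- The event ignores the coordinates below J, so restricting to it leaves the law of such a
coordinate unchanged. -/
lemma tailEvent_update {α P₀ δ : ℝ} {J j : ℕ} (hj : j < J) (ζ : ℕ → ℝ) (t : ℝ) :
    Function.update ζ j t ∈ tailEvent α P₀ δ J ↔ ζ ∈ tailEvent α P₀ δ J := by
  simp only [tailEvent, Set.mem_ofPred_eq]
  refine forall₂_congr fun k hk => ?_
  have : ∀ i, Function.update ζ j t (k + i) = ζ (k + i) := fun i =>
    Function.update_of_ne (by omega) _ _
  simp only [this]

/-- The inequality z² ≤ η z⁴ + 1/η plays the role of Cauchy–Schwarz: second moments over an event of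
small probability are small, uniformly in j. -/
lemma setLIntegral_sq_noise_le {S : Set (ℕ → ℝ)} {η : ℝ}
    (hη : 0 < η) (hSη : noise S ≤ ENNReal.ofReal (η ^ 2)) (j : ℕ) :
    ∫⁻ ζ in S, ENNReal.ofReal (ζ j ^ 2) ∂noise ≤ ENNReal.ofReal (η * (fourthMoment + 1)) := by
  calc ∫⁻ ζ in S, ENNReal.ofReal (ζ j ^ 2) ∂noise
      ≤ ∫⁻ ζ in S, (ENNReal.ofReal (η * ζ j ^ 4) + ENNReal.ofReal (1 / η)) ∂noise := by
        refine lintegral_mono fun ζ => ?_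
        rw [← ENNReal.ofReal_add (by positivity) (by positivity)]
        refine ENNReal.ofReal_le_ofReal ?_
        have h : η * ζ j ^ 4 + 1 / η - ζ j ^ 2 =
            ((η * ζ j ^ 2 - 1 / 2) ^ 2 + 3 / 4) / η := by field_simp; ring
        have : 0 ≤ ((η * ζ j ^ 2 - 1 / 2) ^ 2 + 3 / 4) / η := by positivity
        linarith
    _ = ∫⁻ ζ in S, ENNReal.ofReal (η * ζ j ^ 4) ∂noise + ENNReal.ofReal (1 / η) * noise S := by
        rw [lintegral_add_right _ measurable_const, setLIntegral_const]
    _ ≤ ENNReal.ofReal (η * fourthMoment) + ENNReal.ofReal (1 / η) * ENNReal.ofReal (η ^ 2) := by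
        gcongr
        refine (setLIntegral_le_lintegral _ _).trans ?_
        rw [lintegral_noise_coord j (F := fun t => ENNReal.ofReal (η * t ^ 4)) (by fun_prop),
          lintegral_pow_four_gaussianReal hη.le]
    _ = _ := by
        rw [← ENNReal.ofReal_mul (by positivity), ← ENNReal.ofReal_add
          (mul_nonneg hη.le fourthMoment_nonneg) (by positivity)]
        congr 1
        field_simp

/-! ### The risk sum and the maximal risk of the linear estimator. -/

section

variable {α P₀ ε : ℝ} {σ : ℕ → ℝ}

/-- The `j`-th term of `riskSum`. -/
noncomputable def riskTerm (α P₀ : ℝ) (σ : ℕ → ℝ) (ε : ℝ) (j : ℕ) : ℝ :=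
  thetaSq α P₀ j * (ε * σ j) ^ 2 / (thetaSq α P₀ j + (ε * σ j) ^ 2)

lemma riskTerm_pos (hα : 0 < α) (hP₀ : 0 < P₀) (hσ : ∀ j, 0 < σ j) (hε : 0 < ε) (j : ℕ) :
    0 < riskTerm α P₀ σ ε j := by
  have := thetaSq_pos hα hP₀ j
  have := hσ j
  unfold riskTerm
  positivity

lemma riskTerm_le_thetaSq (hα : 0 < α) (hP₀ : 0 < P₀) (j : ℕ) :
    riskTerm α P₀ σ ε j ≤ thetaSq α P₀ j := by
  have := thetaSq_pos hα hP₀ j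
  unfold riskTerm
  rw [div_le_iff₀ (by positivity)]
  nlinarith

lemma riskTerm_le_sq (hα : 0 < α) (hP₀ : 0 < P₀) (j : ℕ) :
    riskTerm α P₀ σ ε j ≤ (ε * σ j) ^ 2 := by
  have := thetaSq_pos hα hP₀ j
  unfold riskTerm
  rw [div_le_iff₀ (by positivity)]
  nlinarith [sq_nonneg ((ε * σ j) ^ 2)]

lemma riskSum_eq_tsum : riskSum α P₀ σ ε = ∑' j, ENNReal.ofReal (riskTerm α P₀ σ ε j) := by
  unfold riskSum
  rw [← ENNReal.tsum_mul_left]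
  refine tsum_congr fun j => ?_
  rw [← ENNReal.ofReal_mul (sq_nonneg _)]
  congr 1
  unfold riskTerm
  rw [mul_pow]
  ring

lemma ofReal_riskTerm_le_riskSum (j : ℕ) :
    ENNReal.ofReal (riskTerm α P₀ σ ε j) ≤ riskSum α P₀ σ ε := by
  rw [riskSum_eq_tsum]
  exact ENNReal.le_tsum j

lemma riskSum_ne_zero (hα : 0 < α) (hP₀ : 0 < P₀) (hσ : ∀ j, 0 < σ j) (hε : 0 < ε) :
    riskSum α P₀ σ ε ≠ 0 := by
  have h := ENNReal.ofReal_pos.2 (riskTerm_pos hα hP₀ hσ hε 0)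
  exact (h.trans_le (ofReal_riskTerm_le_riskSum 0)).ne'

lemma riskSum_ne_top (hα : 0 < α) (hP₀ : 0 < P₀) : riskSum α P₀ σ ε ≠ ∞ := by
  rw [riskSum_eq_tsum]
  have h := tsum_ofReal_thetaSq_le hα hP₀ 0
  simp only [zero_add] at h
  refine ne_top_of_le_ne_top ENNReal.ofReal_ne_top (le_trans ?_ h)
  exact ENNReal.tsum_le_tsum fun j => ENNReal.ofReal_le_ofReal (riskTerm_le_thetaSq hα hP₀ j)

/-- The noise to signal ratio `σ_j² / θ_j` is increasing where `σ_j² j ^ (2α + 1)` is. -/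
lemma sq_mul_thetaSq_succ_le (hα : 0 < α) (hP₀ : 0 < P₀) (hσ : ∀ j, 0 < σ j) {j : ℕ}
    (h : 1 < (σ (j + 1) ^ 2 * ((j : ℝ) + 2) ^ (2 * α + 1)) /
        (σ j ^ 2 * ((j : ℝ) + 1) ^ (2 * α + 1))) :
    σ j ^ 2 * thetaSq α P₀ (j + 1) ≤ σ (j + 1) ^ 2 * thetaSq α P₀ j := by
  have h1 : (0 : ℝ) < (j : ℝ) + 1 := by positivity
  have h2 : (0 : ℝ) < (j : ℝ) + 2 := by positivity
  have := hσ j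
  have hp1 := Real.rpow_pos_of_pos h1 (2 * α + 1)
  have hp2 := Real.rpow_pos_of_pos h2 (2 * α + 1)
  rw [one_lt_div (by positivity)] at h
  unfold thetaSq
  have e : -2 * α - 1 = -(2 * α + 1) := by ring
  push_cast
  rw [show (j : ℝ) + 1 + 1 = j + 2 by ring, e, Real.rpow_neg h1.le, Real.rpow_neg h2.le,
    ← div_eq_mul_inv, ← div_eq_mul_inv, mul_div_assoc', mul_div_assoc',
    div_le_div_iff₀ hp2 hp1]
  have := mul_le_mul_of_nonneg_left h.le (show 0 ≤ 2 * α * P₀ by positivity)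
  linarith

lemma risk_linearEstimator (lam x : ℕ → ℝ) :
    risk σ ε (linearEstimator lam) x =
      ∑' j, ENNReal.ofReal (((1 - lam j) * x j) ^ 2 + (lam j * (ε * σ j)) ^ 2) := by
  unfold risk loss linearEstimator observation
  rw [lintegral_tsum fun j => Measurable.aemeasurable (by fun_prop)]
  refine tsum_congr fun j => ?_
  rw [lintegral_noise_coord j (F := fun t => ENNReal.ofReal ((lam j * (x j + ε * σ j * t) - x j) ^ 2))
    (by fun_prop)]
  have := lintegral_affine_sq_gaussianReal ((lam j - 1) * x j) (lam j * (ε * σ j))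
  rw [show ((1 - lam j) * x j) ^ 2 = ((lam j - 1) * x j) ^ 2 by ring, ← this]
  refine lintegral_congr fun t => ?_
  congr 2
  ring

lemma tail_sum_le_tailBound {x : ℕ → ℝ} (hx : x ∈ besovBall α P₀) (k : ℕ) :
    ∑' i, x (k + i) ^ 2 ≤ tailBound α P₀ k := by
  have h := hx.2 k
  have hk : (0 : ℝ) < ((k : ℝ) + 1) ^ (-2 * α) := by positivity
  rw [inv_mul_le_iff₀ hk] at h
  rw [tailBound, mul_comm]
  exact h

lemma sq_le_of_mem_besovBall {x : ℕ → ℝ} (hx : x ∈ besovBall α P₀) (j : ℕ) : x j ^ 2 ≤ P₀ := by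
  have h := tail_sum_le_tailBound hx 0
  simp only [zero_add, tailBound, Nat.cast_zero, Real.one_rpow, mul_one] at h
  exact (hx.1.le_tsum j fun i _ => sq_nonneg _).trans h

/-- Increasing weights are, on `besovBall`, largest in total for the extremal sequence. -/
lemma tsum_ofReal_mul_sq_le (hα : 0 < α) (hP₀ : 0 < P₀) {x : ℕ → ℝ} (hx : x ∈ besovBall α P₀)
    {u : ℕ → ℝ} {k : ℕ} (hu0 : ∀ j, 0 ≤ u j) (hu1 : ∀ j, u j ≤ 1)
    (hu : ∀ j, k ≤ j → u j ≤ u (j + 1)) :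
    ∑' i, ENNReal.ofReal (u (k + i) * x (k + i) ^ 2) ≤
      ∑' i, ENNReal.ofReal (u (k + i) * thetaSq α P₀ (k + i)) := by
  set T : ℕ → ℝ := fun n => ∑' i, x (n + i) ^ 2 with hT
  have hTn : ∀ n, 0 ≤ T n := fun n => tsum_nonneg fun i => sq_nonneg _
  have hTs : ∀ n, T n = x n ^ 2 + T (n + 1) := by
    intro n
    have hs : Summable fun i => x (n + i) ^ 2 := by
      simp_rw [add_comm n]
      exact (summable_nat_add_iff n).2 hx.1
    simp only [hT]
    rw [hs.tsum_eq_zero_add]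
    simp only [add_zero]
    congr 1
    refine tsum_congr fun i => ?_
    congr 2
    ring
  -- Summation by parts, carried as an induction that keeps the remaining tail with its current
  -- weight. Raising that weight is paid for by the tail constraint, since the increment of `u` is
  -- nonnegative; one step of `tailBound` is then paid for by θ.
  have key : ∀ n, ∑ i ∈ Finset.range n, u (k + i) * x (k + i) ^ 2 + u (k + n) * T (k + n) ≤
      ∑ i ∈ Finset.range n, u (k + i) * thetaSq α P₀ (k + i) +
        u (k + n) * tailBound α P₀ (k + n) := by
    intro n
    induction n with
    | zero =>
      simpa using mul_le_mul_of_nonneg_left (tail_sum_le_tailBound hx k) (hu0 k)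
    | succ n ih =>
      rw [Finset.sum_range_succ, Finset.sum_range_succ, ← add_assoc]
      have h1 := mul_le_mul_of_nonneg_left (tail_sum_le_tailBound hx (k + n + 1))
        (sub_nonneg.2 (hu (k + n) (by omega)))
      have h2 := mul_le_mul_of_nonneg_left
        (tailBound_sub_succ_le_thetaSq hα hP₀ (k + n)) (hu0 (k + n))
      rw [hTs (k + n)] at ih
      change (u (k + n + 1) - u (k + n)) * T (k + n + 1) ≤ _ at h1
      linarith
  refine le_of_tendsto_of_tendsto' (ENNReal.tendsto_nat_tsum _)
    (b := atTop) (g := fun n => ∑' i, ENNReal.ofReal (u (k + i) * thetaSq α P₀ (k + i)) +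
      ENNReal.ofReal (tailBound α P₀ (k + n))) ?_ fun n => ?_
  · have ht : Tendsto (fun n => ENNReal.ofReal (tailBound α P₀ (k + n))) atTop (𝓝 0) := by
      rw [← ENNReal.ofReal_zero]
      refine ENNReal.tendsto_ofReal ?_
      simp_rw [add_comm k]
      exact (tendsto_add_atTop_iff_nat k).2 (tendsto_tailBound hα)
    simpa using tendsto_const_nhds.add ht
  · have hθ := fun i => (thetaSq_pos hα hP₀ i).le
    rw [← ENNReal.ofReal_sum_of_nonneg fun i _ => mul_nonneg (hu0 _) (sq_nonneg _)]
    calc ENNReal.ofReal (∑ i ∈ Finset.range n, u (k + i) * x (k + i) ^ 2)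
        ≤ ENNReal.ofReal (∑ i ∈ Finset.range n, u (k + i) * thetaSq α P₀ (k + i) +
            tailBound α P₀ (k + n)) := by
          refine ENNReal.ofReal_le_ofReal ?_
          have h1 := key n
          have h2 := mul_nonneg (hu0 (k + n)) (hTn (k + n))
          have h3 := mul_le_mul_of_nonneg_right (hu1 (k + n)) (tailBound_pos (α := α) hP₀ (k + n)).le
          linarith
      _ ≤ _ := by
          rw [ENNReal.ofReal_add (Finset.sum_nonneg fun i _ => mul_nonneg (hu0 _) (hθ _))
            (tailBound_pos hP₀ _).le,
            ENNReal.ofReal_sum_of_nonneg fun i _ => mul_nonneg (hu0 _) (hθ _)]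
          gcongr
          exact ENNReal.sum_le_tsum _

lemma one_sub_weight (hα : 0 < α) (hP₀ : 0 < P₀) (j : ℕ) :
    1 - weight α P₀ σ ε j = (ε * σ j) ^ 2 / (thetaSq α P₀ j + (ε * σ j) ^ 2) := by
  have := thetaSq_pos hα hP₀ j
  unfold weight
  have h : thetaSq α P₀ j + ε ^ 2 * σ j ^ 2 ≠ 0 := by positivity
  rw [mul_pow]
  field_simp
  ring

/-- The maximal risk of the linear estimator exceeds `riskSum` by a lower order term at most. -/
lemma maxRisk_linearEstimator_le (hα : 0 < α) (hP₀ : 0 < P₀) {j₀ : ℕ}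
    (hmono : ∀ j, j₀ ≤ j → σ j ^ 2 * thetaSq α P₀ (j + 1) ≤ σ (j + 1) ^ 2 * thetaSq α P₀ j) :
    maxRisk σ ε (besovBall α P₀) (linearEstimator (weight α P₀ σ ε)) ≤
      riskSum α P₀ σ ε +
        ENNReal.ofReal (ε ^ 4 * ∑ j ∈ Finset.range j₀, P₀ * (σ j ^ 2 / thetaSq α P₀ j) ^ 2) := by
  set g : ℕ → ℝ := fun j => 1 - weight α P₀ σ ε j with hg
  have hθ := fun j => thetaSq_pos hα hP₀ j
  have hg' : ∀ j, g j = (ε * σ j) ^ 2 / (thetaSq α P₀ j + (ε * σ j) ^ 2) :=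
    fun j => one_sub_weight hα hP₀ j
  have hg0 : ∀ j, 0 ≤ g j := fun j => by
    rw [hg']; have := hθ j; positivity
  have hg1 : ∀ j, g j ≤ 1 := fun j => by
    have := hθ j
    rw [hg', div_le_one (by positivity)]; linarith
  have hgm : ∀ j, j₀ ≤ j → g j ≤ g (j + 1) := fun j hj => by
    have := hθ j
    have := hθ (j + 1)
    rw [hg', hg', div_le_div_iff₀ (by positivity) (by positivity)]
    have := mul_le_mul_of_nonneg_left (hmono j hj) (sq_nonneg ε)
    nlinarith
  -- Below j₀ the weights need not increase, but each `g j` is O(ε²), so the squared bias there is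
  -- O(ε⁴).
  have hgr : ∀ j, g j ≤ ε ^ 2 * (σ j ^ 2 / thetaSq α P₀ j) := fun j => by
    have := hθ j
    rw [hg', ← mul_div_assoc, ← mul_pow]
    gcongr
    nlinarith [sq_nonneg (ε * σ j)]
  have split : ∀ f : ℕ → ℝ≥0∞, ∑ j ∈ Finset.range j₀, f j + ∑' i, f (j₀ + i) = ∑' j, f j := by
    intro f
    simp_rw [add_comm j₀]
    exact ENNReal.summable.sum_add_tsum_nat_add'
  refine iSup₂_le fun x hx => ?_
  rw [risk_linearEstimator, riskSum_eq_tsum]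
  -- Squared bias plus variance when x_j² = θ_j. The variance part is the same for every x and
  -- cancels from the comparison.
  have e1 : ∀ j, ENNReal.ofReal (riskTerm α P₀ σ ε j) =
      ENNReal.ofReal (g j ^ 2 * thetaSq α P₀ j) +
        ENNReal.ofReal ((weight α P₀ σ ε j * (ε * σ j)) ^ 2) := by
    intro j
    have := hθ j
    rw [← ENNReal.ofReal_add (by positivity) (by positivity), hg']
    congr 1
    have h : weight α P₀ σ ε j = thetaSq α P₀ j / (thetaSq α P₀ j + (ε * σ j) ^ 2) := by
      rw [weight, mul_pow]
    rw [h, riskTerm]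
    have h : thetaSq α P₀ j + (ε * σ j) ^ 2 ≠ 0 := by positivity
    field_simp
    ring
  have e2 : ∀ j, ENNReal.ofReal (((1 - weight α P₀ σ ε j) * x j) ^ 2 +
      (weight α P₀ σ ε j * (ε * σ j)) ^ 2) = ENNReal.ofReal (g j ^ 2 * x j ^ 2) +
        ENNReal.ofReal ((weight α P₀ σ ε j * (ε * σ j)) ^ 2) := by
    intro j
    rw [← ENNReal.ofReal_add (by positivity) (by positivity), mul_pow]
  simp_rw [e1, e2]
  rw [ENNReal.tsum_add, ENNReal.tsum_add, add_right_comm]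
  gcongr
  rw [← split, ← split (fun j => ENNReal.ofReal (g j ^ 2 * thetaSq α P₀ j)), add_comm,
    add_assoc, add_comm]
  have h1 := tsum_ofReal_mul_sq_le hα hP₀ hx (u := fun j => g j ^ 2) (k := j₀)
    (fun j => sq_nonneg _) (fun j => pow_le_one₀ (hg0 j) (hg1 j))
    (fun j hj => pow_le_pow_left₀ (hg0 j) (hgm j hj) 2)
  have h2 : ∑ j ∈ Finset.range j₀, ENNReal.ofReal (g j ^ 2 * x j ^ 2) ≤
      ENNReal.ofReal (ε ^ 4 * ∑ j ∈ Finset.range j₀, P₀ * (σ j ^ 2 / thetaSq α P₀ j) ^ 2) := by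
    rw [← ENNReal.ofReal_sum_of_nonneg fun j _ => by positivity, Finset.mul_sum]
    refine ENNReal.ofReal_le_ofReal (Finset.sum_le_sum fun j _ => ?_)
    calc g j ^ 2 * x j ^ 2 ≤ (ε ^ 2 * (σ j ^ 2 / thetaSq α P₀ j)) ^ 2 * P₀ := by
          gcongr
          · exact hg0 j
          · exact hgr j
          · exact sq_le_of_mem_besovBall hx j
      _ = _ := by ring
  calc _ ≤ _ := add_le_add h2 h1
    _ ≤ _ := by
      rw [add_comm]
      exact le_add_left le_rfl

end

/-! ### Reduction of the average risk to one coordinate. -/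

lemma measurable_observation_prod {X : (ℕ → ℝ) → (ℕ → ℝ)} (hX : Measurable X) (σ : ℕ → ℝ) (ε : ℝ) :
    Measurable fun p : (ℕ → ℝ) × (ℕ → ℝ) => observation σ ε (X p.1) p.2 := by
  refine measurable_pi_lambda _ fun i => ?_
  have := (measurable_pi_apply i).comp hX
  have h1 : Measurable fun p : (ℕ → ℝ) × (ℕ → ℝ) => X p.1 i := this.comp measurable_fst
  unfold observation
  fun_prop

/-- The average risk in one coordinate is at least the scalar Bayes risk. -/
lemma mul_measure_le_setLIntegral_coord {h : ℕ → ℝ → ℝ} (hm : ∀ i, Measurable (h i)) (σ : ℕ → ℝ)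
    (ε : ℝ) {est : (ℕ → ℝ) → ℝ} (hest : Measurable est) (j : ℕ) {E : Set (ℕ → ℝ)}
    (hE : MeasurableSet E) (hEj : ∀ ζ t, Function.update ζ j t ∈ E ↔ ζ ∈ E) {b : ℝ≥0∞}
    (hb : ∀ f : ℝ → ℝ, Measurable f → b ≤ ∫⁻ t, ∫⁻ s,
      ENNReal.ofReal ((f (h j t + ε * σ j * s) - h j t) ^ 2) ∂gaussianReal 0 1 ∂gaussianReal 0 1) :
    b * noise E ≤ ∫⁻ ζ in E, ∫⁻ ξ, ENNReal.ofReal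
      ((est (observation σ ε (fun i => h i (ζ i)) ξ) - h j (ζ j)) ^ 2) ∂noise ∂noise := by
  set L : (ℕ → ℝ) → (ℕ → ℝ) → ℝ≥0∞ := fun ζ ξ => ENNReal.ofReal
      ((est (observation σ ε (fun i => h i (ζ i)) ξ) - h j (ζ j)) ^ 2) with hL
  have hX : Measurable fun (ζ : ℕ → ℝ) i => h i (ζ i) :=
    measurable_pi_lambda _ fun i => (hm i).comp (measurable_pi_apply i)
  have hLm : Measurable (Function.uncurry L) := by
    have h1 : Measurable fun p : (ℕ → ℝ) × (ℕ → ℝ) => h j (p.1 j) :=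
      (hm j).comp ((measurable_pi_apply j).comp measurable_fst)
    have h2 := hest.comp (measurable_observation_prod hX σ ε)
    exact ((h2.sub h1).pow_const 2).ennreal_ofReal
  have e1 : b * noise E = ∫⁻ ζ, E.indicator (fun _ => b) ζ ∂noise := by
    rw [lintegral_indicator hE, setLIntegral_const]
  have e2 : ∫⁻ ζ in E, ∫⁻ ξ, L ζ ξ ∂noise ∂noise =
      ∫⁻ ζ, ∫⁻ ξ, E.indicator (fun _ => L ζ ξ) ζ ∂noise ∂noise := by
    rw [← lintegral_indicator hE]
    refine lintegral_congr fun ζ => ?_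
    by_cases hζ : ζ ∈ E <;> simp [hζ]
  rw [e1, e2]
  refine lintegral_le_lintegral_noise_noise j (F := fun ζ ξ => E.indicator (fun _ => L ζ ξ) ζ)
    ?_ fun ζ ξ => ?_
  · have : (Function.uncurry fun ζ ξ => E.indicator (fun _ => L ζ ξ) ζ) =
        (Prod.fst ⁻¹' E).indicator (Function.uncurry L) := by
      ext ⟨ζ, ξ⟩
      by_cases hζ : ζ ∈ E <;> simp [hζ]
    rw [this]
    exact hLm.indicator (measurable_fst hE)
  · by_cases hζ : ζ ∈ E
    · simp only [Set.indicator_of_mem hζ, Set.indicator_of_mem ((hEj ζ _).2 hζ)]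
      -- With every other coordinate of signal and noise frozen, the estimator is a function of the
      -- j-th observation alone, so the scalar bound applies.
      have hf : Measurable fun y : ℝ =>
          est (Function.update (observation σ ε (fun i => h i (ζ i)) ξ) j y) :=
        hest.comp (measurable_update _)
      refine (hb _ hf).trans (le_of_eq (lintegral_congr fun t => lintegral_congr fun s => ?_))
      simp only [hL]
      congr 3
      · congr 1
        ext i
        by_cases hi : i = j
        · subst hi; simp [observation]
        · simp [observation, hi]
      · simp
    · simp [hζ]

/-! ### The least favourable prior and its Bayes risks. -/

section

variable {α P₀ δ τ κ ε : ℝ} {σ : ℕ → ℝ} {J : ℕ}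

/-- The coordinates of the least favourable prior as functions of standard Gaussian variables:
truncated Gaussian with small variance below `J`, Gaussian with nearly extremal variance from
`J` on. -/
noncomputable def priorCoord (α P₀ δ τ κ : ℝ) (σ : ℕ → ℝ) (ε : ℝ) (J j : ℕ) (t : ℝ) : ℝ :=
  if j < J then truncMul (ε * σ j / κ) √(τ * thetaSq α P₀ j) t
  else √((1 - 2 * δ) * thetaSq α P₀ j) * t

lemma measurable_priorCoord (j : ℕ) : Measurable (priorCoord α P₀ δ τ κ σ ε J j) := by
  unfold priorCoord
  split_ifs
  · exact measurable_truncMul _ _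
  · fun_prop

lemma priorCoord_sq_le_of_lt (hα : 0 < α) (hP₀ : 0 < P₀) (hτ : 0 < τ) {j : ℕ} (hj : j < J) (t : ℝ) :
    priorCoord α P₀ δ τ κ σ ε J j t ^ 2 ≤ τ * thetaSq α P₀ j := by
  have := thetaSq_pos hα hP₀ j
  rw [priorCoord, if_pos hj]
  exact (truncMul_sq_le (Real.sqrt_nonneg _) t).trans (Real.sq_sqrt (by positivity)).le

lemma priorCoord_sq_of_le (hα : 0 < α) (hP₀ : 0 < P₀) (hδ' : δ < 1 / 2) {j : ℕ} (hj : J ≤ j)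
    (t : ℝ) : priorCoord α P₀ δ τ κ σ ε J j t ^ 2 = (1 - 2 * δ) * thetaSq α P₀ j * t ^ 2 := by
  have := thetaSq_pos hα hP₀ j
  have : 0 < 1 - 2 * δ := by linarith
  rw [priorCoord, if_neg (by omega), mul_pow, Real.sq_sqrt (by positivity)]

lemma mem_besovBall_of_tsum_le (hP₀ : 0 < P₀) {x : ℕ → ℝ}
    (h : ∀ k, ∑' i, ENNReal.ofReal (x (k + i) ^ 2) ≤ ENNReal.ofReal (tailBound α P₀ k)) :
    x ∈ besovBall α P₀ := by
  have hs : Summable fun j => x j ^ 2 := by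
    have h0 := ne_top_of_le_ne_top ENNReal.ofReal_ne_top (h 0)
    simpa [ENNReal.toReal_ofReal (sq_nonneg _)] using ENNReal.summable_toReal h0
  refine ⟨hs, fun k => ?_⟩
  have hk : (0 : ℝ) < ((k : ℝ) + 1) ^ (-2 * α) := by positivity
  rw [inv_mul_le_iff₀ hk, mul_comm]
  have hsk : Summable fun i => x (k + i) ^ 2 := by
    simp_rw [add_comm k]
    exact (summable_nat_add_iff k).2 hs
  have hk' := h k
  rw [← ENNReal.ofReal_tsum_of_nonneg (fun i => sq_nonneg _) hsk,
    ENNReal.ofReal_le_ofReal_iff (tailBound_pos hP₀ k).le] at hk'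
  exact hk'

lemma tsum_priorCoord_sq_le (hα : 0 < α) (hP₀ : 0 < P₀) (hδ' : δ < 1 / 2) {ζ : ℕ → ℝ}
    (hζ : ζ ∈ tailEvent α P₀ δ J) {k : ℕ} (hk : J ≤ k) :
    ∑' i, ENNReal.ofReal (priorCoord α P₀ δ τ κ σ ε J (k + i) (ζ (k + i)) ^ 2) ≤
      ENNReal.ofReal ((1 - δ) * tailBound α P₀ k) := by
  refine le_trans (le_of_eq (tsum_congr fun i => ?_)) (hζ k hk)
  rw [priorCoord_sq_of_le hα hP₀ hδ' (by omega)]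

/-- For k < J the truncated coordinates use at most τ (1 + 2α) ≤ δ of the tail budget at k, whatever
`ζ` is. The event leaves the Gaussian coordinates the share 1 - δ. -/
lemma priorCoord_mem_besovBall (hα : 0 < α) (hP₀ : 0 < P₀) (hδ : 0 < δ) (hδ' : δ < 1 / 2)
    (hτ : 0 < τ) (hτδ : τ * (1 + 2 * α) ≤ δ) {ζ : ℕ → ℝ} (hζ : ζ ∈ tailEvent α P₀ δ J) :
    (fun j => priorCoord α P₀ δ τ κ σ ε J j (ζ j)) ∈ besovBall α P₀ := by
  refine mem_besovBall_of_tsum_le hP₀ fun k => ?_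
  have hΘ := tailBound_pos (α := α) hP₀ k
  rcases le_or_gt J k with hk | hk
  · refine (tsum_priorCoord_sq_le hα hP₀ hδ' hζ hk).trans (ENNReal.ofReal_le_ofReal ?_)
    nlinarith
  · have split := (ENNReal.summable (f := fun i => ENNReal.ofReal
      (priorCoord α P₀ δ τ κ σ ε J (k + (i + (J - k))) (ζ (k + (i + (J - k)))) ^ 2))).sum_add_tsum_nat_add'
      (f := fun i => ENNReal.ofReal (priorCoord α P₀ δ τ κ σ ε J (k + i) (ζ (k + i)) ^ 2))
    rw [← split]
    have h1 : ∑ i ∈ Finset.range (J - k),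
        ENNReal.ofReal (priorCoord α P₀ δ τ κ σ ε J (k + i) (ζ (k + i)) ^ 2) ≤
        ENNReal.ofReal (τ * ((1 + 2 * α) * tailBound α P₀ k)) := by
      rw [← ENNReal.ofReal_sum_of_nonneg fun i _ => sq_nonneg _]
      refine ENNReal.ofReal_le_ofReal ?_
      refine le_trans ?_ (mul_le_mul_of_nonneg_left (sum_thetaSq_le_mul hα hP₀ k (J - k)) hτ.le)
      rw [Finset.mul_sum]
      refine Finset.sum_le_sum fun i hi => ?_
      have := Finset.mem_range.1 hi
      exact priorCoord_sq_le_of_lt hα hP₀ hτ (by omega) _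
    have h2 : ∑' i, ENNReal.ofReal
        (priorCoord α P₀ δ τ κ σ ε J (k + (i + (J - k))) (ζ (k + (i + (J - k)))) ^ 2) ≤
        ENNReal.ofReal ((1 - δ) * tailBound α P₀ k) := by
      have e : ∀ i, k + (i + (J - k)) = J + i := fun i => by omega
      simp_rw [e]
      refine (tsum_priorCoord_sq_le hα hP₀ hδ' hζ le_rfl).trans (ENNReal.ofReal_le_ofReal ?_)
      have := tailBound_antitone hα hP₀ hk.le
      have : 0 ≤ 1 - δ := by linarith
      gcongr
    refine (add_le_add h1 h2).trans ?_
    rw [← ENNReal.ofReal_add (by positivity) (mul_nonneg (by linarith) hΘ.le)]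
    refine ENNReal.ofReal_le_ofReal ?_
    nlinarith

/-- With noise level d = ε σ_j, the prior variance d² / κ² swamps the noise and the untruncated
Bayes risk is at least (1 - κ) d². Truncation at √(τ θ_j) costs 4 d⁴ / (κ⁴ τ θ_j) times the fourth
moment; the factor κ⁵ in `hlow` makes this at most 4κ d² times that moment. -/
lemma ofReal_le_lintegral_priorCoord_of_lt (hα : 0 < α) (hP₀ : 0 < P₀) (hσ : ∀ j, 0 < σ j)
    (hε : 0 < ε) (hτ : 0 < τ) (hκ : 0 < κ) (hκ1 : κ ≤ 1) {j : ℕ} (hj : j < J)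
    (hlow : (ε * σ j) ^ 2 ≤ τ * κ ^ 5 * thetaSq α P₀ j) {f : ℝ → ℝ} (hf : Measurable f) :
    ENNReal.ofReal ((1 - κ * (1 + 4 * fourthMoment)) * riskTerm α P₀ σ ε j) ≤
      ∫⁻ t, ∫⁻ s, ENNReal.ofReal ((f (priorCoord α P₀ δ τ κ σ ε J j t + ε * σ j * s) -
        priorCoord α P₀ δ τ κ σ ε J j t) ^ 2) ∂gaussianReal 0 1 ∂gaussianReal 0 1 := by
  have hθ := thetaSq_pos hα hP₀ j
  have hd : 0 < ε * σ j := mul_pos hε (hσ j)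
  have hC := fourthMoment_nonneg
  have key := truncated_bayes_le (div_pos hd hκ) hd
    (Real.sqrt_pos.2 (mul_pos hτ hθ)) hf
  simp only [priorCoord, if_pos hj]
  refine le_trans ?_ key
  set d := ε * σ j with hdd
  rcases le_or_gt (1 - κ * (1 + 4 * fourthMoment)) 0 with hneg | hpos
  · rw [ENNReal.ofReal_of_nonpos]
    · exact zero_le
    · exact mul_nonpos_of_nonpos_of_nonneg hneg (riskTerm_pos hα hP₀ hσ hε j).le
  refine ENNReal.ofReal_le_ofReal ?_
  refine (mul_le_mul_of_nonneg_left (riskTerm_le_sq hα hP₀ j) hpos.le).trans ?_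
  rw [Real.sq_sqrt (by positivity), ← hdd]
  have h1 : (1 - κ) * d ^ 2 ≤ (d / κ) ^ 2 * d ^ 2 / ((d / κ) ^ 2 + d ^ 2) := by
    have : (d / κ) ^ 2 * d ^ 2 / ((d / κ) ^ 2 + d ^ 2) = d ^ 2 / (1 + κ ^ 2) := by field_simp
    rw [this, le_div_iff₀ (by positivity)]
    have : (1 - κ) * (1 + κ ^ 2) ≤ 1 := by nlinarith [pow_pos hκ 3]
    nlinarith [sq_nonneg d]
  have h2 : 4 * (d / κ) ^ 4 / (τ * thetaSq α P₀ j) ≤ 4 * κ * d ^ 2 := by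
    rw [div_le_iff₀ (by positivity), div_pow, mul_div_assoc', div_le_iff₀ (by positivity)]
    have := mul_le_mul_of_nonneg_left hlow (show 0 ≤ 4 * d ^ 2 by positivity)
    linarith
  have h3 := mul_le_mul_of_nonneg_right h2 hC
  linarith

lemma ofReal_le_lintegral_priorCoord_of_le (hα : 0 < α) (hP₀ : 0 < P₀) (hσ : ∀ j, 0 < σ j)
    (hε : 0 < ε) (hδ : 0 < δ) (hδ' : δ < 1 / 2) {j : ℕ} (hj : J ≤ j)
    {f : ℝ → ℝ} (hf : Measurable f) :
    ENNReal.ofReal ((1 - 2 * δ) * riskTerm α P₀ σ ε j) ≤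
      ∫⁻ t, ∫⁻ s, ENNReal.ofReal ((f (priorCoord α P₀ δ τ κ σ ε J j t + ε * σ j * s) -
        priorCoord α P₀ δ τ κ σ ε J j t) ^ 2) ∂gaussianReal 0 1 ∂gaussianReal 0 1 := by
  have hθ := thetaSq_pos hα hP₀ j
  have hd : 0 < ε * σ j := mul_pos hε (hσ j)
  have hδ2 : 0 < 1 - 2 * δ := by linarith
  have key := gaussian_bayes_le (Real.sqrt_pos.2 (mul_pos hδ2 hθ)) hd hf
  simp only [priorCoord, if_neg (show ¬ j < J by omega)]
  refine le_trans (ENNReal.ofReal_le_ofReal ?_) key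
  rw [Real.sq_sqrt (by positivity), riskTerm, mul_div_assoc', ← mul_assoc]
  gcongr
  nlinarith

/-! ### Cutting off the tail of an estimator. -/

/-- Tail loss of the zero sequence and of a sequence with large tail. -/
lemma tsum_sq_le_tsum_sub_sq {u x : ℕ → ℝ} {R : ℝ≥0∞} (hx : ∑' i, ENNReal.ofReal (x i ^ 2) ≤ R)
    (hu : 4 * R < ∑' i, ENNReal.ofReal (u i ^ 2)) :
    ∑' i, ENNReal.ofReal (x i ^ 2) ≤ ∑' i, ENNReal.ofReal ((u i - x i) ^ 2) := by
  by_contra! hlt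
  have h1 : ∑' i, ENNReal.ofReal (u i ^ 2) ≤
      2 * ∑' i, ENNReal.ofReal ((u i - x i) ^ 2) + 2 * ∑' i, ENNReal.ofReal (x i ^ 2) := by
    rw [← ENNReal.tsum_mul_left, ← ENNReal.tsum_mul_left, ← ENNReal.tsum_add]
    refine ENNReal.tsum_le_tsum fun i => ?_
    rw [show (2 : ℝ≥0∞) = ENNReal.ofReal 2 by simp, ← ENNReal.ofReal_mul (by norm_num),
      ← ENNReal.ofReal_mul (by norm_num), ← ENNReal.ofReal_add (by positivity) (by positivity)]
    refine ENNReal.ofReal_le_ofReal ?_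
    nlinarith [sq_nonneg (u i - 2 * x i)]
  have h2 : 2 * ∑' i, ENNReal.ofReal ((u i - x i) ^ 2) + 2 * ∑' i, ENNReal.ofReal (x i ^ 2) ≤
      4 * R := by
    calc _ ≤ 2 * R + 2 * R := by gcongr; exact hlt.le.trans hx
      _ = 4 * R := by rw [← add_mul]; norm_num
  exact absurd (h1.trans h2) (not_le.2 hu)

lemma tsum_sub_sq_le (u x : ℕ → ℝ) :
    ∑' i, ENNReal.ofReal ((u i - x i) ^ 2) ≤
      2 * ∑' i, ENNReal.ofReal (u i ^ 2) + 2 * ∑' i, ENNReal.ofReal (x i ^ 2) := by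
  rw [← ENNReal.tsum_mul_left, ← ENNReal.tsum_mul_left, ← ENNReal.tsum_add]
  refine ENNReal.tsum_le_tsum fun i => ?_
  rw [show (2 : ℝ≥0∞) = ENNReal.ofReal 2 by simp, ← ENNReal.ofReal_mul (by norm_num),
    ← ENNReal.ofReal_mul (by norm_num), ← ENNReal.ofReal_add (by positivity) (by positivity)]
  refine ENNReal.ofReal_le_ofReal ?_
  nlinarith [sq_nonneg (u i + x i)]

/-- The sequence `u` shifted by `J`, replaced by zero if its norm is too large. -/
noncomputable def cutTail (J : ℕ) (R : ℝ≥0∞) (u : ℕ → ℝ) (i : ℕ) : ℝ :=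
  if ∑' i, ENNReal.ofReal (u (J + i) ^ 2) ≤ 4 * R then u (J + i) else 0

lemma measurable_cutTail (J : ℕ) (R : ℝ≥0∞) (i : ℕ) : Measurable fun u => cutTail J R u i :=
  Measurable.ite (measurableSet_le (Measurable.tsum fun i => by fun_prop) measurable_const)
    (by fun_prop) measurable_const

/-- When the true tail has energy at most R, an estimate of tail energy above 4R is no better than
zero, so cutting does no harm. -/
lemma tsum_cutTail_sub_sq_le {u x : ℕ → ℝ} {R : ℝ≥0∞}
    (hx : ∑' i, ENNReal.ofReal (x (J + i) ^ 2) ≤ R) :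
    ∑' i, ENNReal.ofReal ((cutTail J R u i - x (J + i)) ^ 2) ≤
      ∑' i, ENNReal.ofReal ((u (J + i) - x (J + i)) ^ 2) := by
  by_cases h : ∑' i, ENNReal.ofReal (u (J + i) ^ 2) ≤ 4 * R
  · simp [cutTail, h]
  · simpa [cutTail, h] using tsum_sq_le_tsum_sub_sq hx (not_le.1 h)

/-- This holds without any bound on the tail of `x`, and so keeps the loss of the cut estimator
under control off `tailEvent`. -/
lemma tsum_cutTail_sub_sq_le' (u x : ℕ → ℝ) (R : ℝ≥0∞) :
    ∑' i, ENNReal.ofReal ((cutTail J R u i - x (J + i)) ^ 2) ≤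
      8 * R + 2 * ∑' i, ENNReal.ofReal (x (J + i) ^ 2) := by
  refine (tsum_sub_sq_le _ _).trans ?_
  rw [show (8 : ℝ≥0∞) * R = 2 * (4 * R) by rw [← mul_assoc]; norm_num]
  gcongr
  by_cases h : ∑' i, ENNReal.ofReal (u (J + i) ^ 2) ≤ 4 * R
  · simp [cutTail, h]
  · simp [cutTail, h]

/-- The part of the average tail loss on the complement of `tailEvent`. -/
lemma setLIntegral_tail_le (hα : 0 < α) (hP₀ : 0 < P₀) (hδ : 0 < δ) (hδ' : δ < 1 / 2) {μ : ℝ}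
    (hμ : 0 < μ) (hμ1 : μ ≤ 1) {S : Set (ℕ → ℝ)} (hS : noise S ≤ ENNReal.ofReal (μ ^ 2)) :
    ∫⁻ ζ in S, (8 * ENNReal.ofReal (tailBound α P₀ J) +
      2 * ∑' i, ENNReal.ofReal (priorCoord α P₀ δ τ κ σ ε J (J + i) (ζ (J + i)) ^ 2)) ∂noise ≤
    ENNReal.ofReal (μ * (8 + 2 * (1 + 2 * α) * (fourthMoment + 1)) * tailBound α P₀ J) := by
  have hC := fourthMoment_nonneg
  have hΘ := tailBound_pos (α := α) hP₀ J
  rw [lintegral_add_left measurable_const, setLIntegral_const,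
    lintegral_const_mul' _ _ (by norm_num), lintegral_tsum fun i => by
      have : Measurable fun ζ : ℕ → ℝ => priorCoord α P₀ δ τ κ σ ε J (J + i) (ζ (J + i)) :=
        (measurable_priorCoord _).comp (measurable_pi_apply _)
      exact ((this.pow_const 2).ennreal_ofReal).aemeasurable]
  have h1 : ∀ i, ∫⁻ ζ in S, ENNReal.ofReal
      (priorCoord α P₀ δ τ κ σ ε J (J + i) (ζ (J + i)) ^ 2) ∂noise ≤
      ENNReal.ofReal (μ * (fourthMoment + 1)) * ENNReal.ofReal (thetaSq α P₀ (J + i)) := by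
    intro i
    have hθ := thetaSq_pos hα hP₀ (J + i)
    have hδ2 : 0 ≤ 1 - 2 * δ := by linarith
    calc _ ≤ ∫⁻ ζ in S, ENNReal.ofReal (thetaSq α P₀ (J + i)) *
          ENNReal.ofReal (ζ (J + i) ^ 2) ∂noise := by
          refine lintegral_mono fun ζ => ?_
          rw [← ENNReal.ofReal_mul hθ.le, priorCoord_sq_of_le hα hP₀ hδ' (by omega)]
          refine ENNReal.ofReal_le_ofReal ?_
          gcongr
          nlinarith
      _ ≤ _ := by
          rw [lintegral_const_mul' _ _ ENNReal.ofReal_ne_top, mul_comm]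
          gcongr
          exact setLIntegral_sq_noise_le hμ hS _
  have h2 : ∑' i, ∫⁻ ζ in S, ENNReal.ofReal
      (priorCoord α P₀ δ τ κ σ ε J (J + i) (ζ (J + i)) ^ 2) ∂noise ≤
      ENNReal.ofReal (μ * (fourthMoment + 1) * ((1 + 2 * α) * tailBound α P₀ J)) := by
    refine (ENNReal.tsum_le_tsum h1).trans ?_
    rw [ENNReal.tsum_mul_left, ENNReal.ofReal_mul (p := μ * (fourthMoment + 1)) (by positivity)]
    exact mul_le_mul_right (tsum_ofReal_thetaSq_le hα hP₀ J) _
  calc _ ≤ 8 * ENNReal.ofReal (tailBound α P₀ J) * ENNReal.ofReal (μ ^ 2) +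
        2 * ENNReal.ofReal (μ * (fourthMoment + 1) * ((1 + 2 * α) * tailBound α P₀ J)) := by
        exact add_le_add (mul_le_mul_right hS _) (mul_le_mul_right h2 _)
    _ = ENNReal.ofReal (8 * tailBound α P₀ J * μ ^ 2 +
        2 * (μ * (fourthMoment + 1) * ((1 + 2 * α) * tailBound α P₀ J))) := by
        rw [ENNReal.ofReal_add (by positivity) (by positivity),
          ENNReal.ofReal_mul (p := 8 * tailBound α P₀ J) (by positivity),
          ENNReal.ofReal_mul (p := 8) (by norm_num), ENNReal.ofReal_mul (p := 2) (by norm_num),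
          ENNReal.ofReal_ofNat, ENNReal.ofReal_ofNat]
    _ ≤ _ := by
        refine ENNReal.ofReal_le_ofReal ?_
        have : μ ^ 2 ≤ μ := by nlinarith
        nlinarith [mul_le_mul_of_nonneg_left this (show 0 ≤ 8 * tailBound α P₀ J by positivity)]

end

/-! ### The minimax lower bound. -/

section

variable {α P₀ δ τ κ ε : ℝ} {σ : ℕ → ℝ} {J : ℕ}

/-- The Bayes lower bound for the maximal risk of an arbitrary estimator. -/
lemma mul_riskSum_le_maxRisk_add (hα : 0 < α) (hP₀ : 0 < P₀) (hσ : ∀ j, 0 < σ j) (hε : 0 < ε)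
    (hδ : 0 < δ) (hδ' : δ < 1 / 2) (hτ : 0 < τ) (hτδ : τ * (1 + 2 * α) ≤ δ) (hκ : 0 < κ)
    (hκ1 : κ ≤ 1) (hκδ : κ * (1 + 4 * fourthMoment) ≤ 2 * δ)
    (hlow : ∀ j, j < J → (ε * σ j) ^ 2 ≤ τ * κ ^ 5 * thetaSq α P₀ j)
    (hhigh : ∀ j, J ≤ j → τ * κ ^ 5 * thetaSq α P₀ j ≤ (ε * σ j) ^ 2)
    {μ : ℝ} (hμ : 0 < μ) (hμ1 : μ ≤ 1)
    (hE : noise (tailEvent α P₀ δ J)ᶜ ≤ ENNReal.ofReal (μ ^ 2))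
    {est : (ℕ → ℝ) → (ℕ → ℝ)} (hest : Measurable est) :
    ENNReal.ofReal ((1 - 2 * δ) * (1 - μ ^ 2)) * riskSum α P₀ σ ε ≤
      maxRisk σ ε (besovBall α P₀) est +
        ENNReal.ofReal (μ * (8 + 2 * (1 + 2 * α) * (fourthMoment + 1)) *
          ((1 + τ * κ ^ 5) / (τ * κ ^ 5))) * riskSum α P₀ σ ε := by
  set E := tailEvent α P₀ δ J with hEdef
  set h := priorCoord α P₀ δ τ κ σ ε J with hh
  set X : (ℕ → ℝ) → (ℕ → ℝ) := fun ζ i => h i (ζ i) with hX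
  set Y : (ℕ → ℝ) → (ℕ → ℝ) → (ℕ → ℝ) := fun ζ ξ => observation σ ε (X ζ) ξ with hY
  set R : ℝ≥0∞ := ENNReal.ofReal (tailBound α P₀ J) with hR
  set Q : (ℕ → ℝ) → ℝ≥0∞ := fun ζ =>
    8 * R + 2 * ∑' i, ENNReal.ofReal (X ζ (J + i) ^ 2) with hQ
  have hEm : MeasurableSet E := measurableSet_tailEvent α P₀ δ J
  have hC := fourthMoment_nonneg
  have hΘ := tailBound_pos (α := α) hP₀ J
  have hδ2 : 0 ≤ 1 - 2 * δ := by linarith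
  have hm : ∀ i, Measurable (h i) := fun i => measurable_priorCoord i
  have hXm : Measurable X :=
    measurable_pi_lambda _ fun i => (hm i).comp (measurable_pi_apply i)
  have hYm : Measurable fun p : (ℕ → ℝ) × (ℕ → ℝ) => Y p.1 p.2 :=
    measurable_observation_prod hXm σ ε
  have hXj : ∀ j, Measurable fun p : (ℕ → ℝ) × (ℕ → ℝ) => X p.1 j := fun j =>
    ((measurable_pi_apply j).comp hXm).comp measurable_fst
  set A : ℕ → (ℕ → ℝ) → (ℕ → ℝ) → ℝ≥0∞ := fun j ζ ξ =>
    ENNReal.ofReal ((est (Y ζ ξ) j - X ζ j) ^ 2) with hA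
  set B : ℕ → (ℕ → ℝ) → (ℕ → ℝ) → ℝ≥0∞ := fun i ζ ξ =>
    ENNReal.ofReal ((cutTail J R (est (Y ζ ξ)) i - X ζ (J + i)) ^ 2) with hB
  have hAm : ∀ j, Measurable (Function.uncurry (A j)) := fun j => by
    have h1 : Measurable fun p : (ℕ → ℝ) × (ℕ → ℝ) => est (Y p.1 p.2) j :=
      (measurable_pi_apply j).comp (hest.comp hYm)
    have h2 : Measurable fun p : (ℕ → ℝ) × (ℕ → ℝ) =>
        ENNReal.ofReal ((est (Y p.1 p.2) j - X p.1 j) ^ 2) :=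
      ((h1.sub (hXj j)).pow_const 2).ennreal_ofReal
    exact h2
  have hBm : ∀ i, Measurable (Function.uncurry (B i)) := fun i => by
    have h1 : Measurable fun p : (ℕ → ℝ) × (ℕ → ℝ) => cutTail J R (est (Y p.1 p.2)) i :=
      (measurable_cutTail J R i).comp (hest.comp hYm)
    have h2 : Measurable fun p : (ℕ → ℝ) × (ℕ → ℝ) =>
        ENNReal.ofReal ((cutTail J R (est (Y p.1 p.2)) i - X p.1 (J + i)) ^ 2) :=
      ((h1.sub (hXj (J + i))).pow_const 2).ennreal_ofReal
    exact h2
  have hA1 : ∀ j ζ, Measurable (A j ζ) := fun j ζ => (hAm j).of_uncurry_left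
  have hB1 : ∀ i ζ, Measurable (B i ζ) := fun i ζ => (hBm i).of_uncurry_left
  have hA2 : ∀ j, Measurable fun ζ => ∫⁻ ξ, A j ζ ξ ∂noise := fun j =>
    (hAm j).lintegral_prod_right
  have hB2 : ∀ i, Measurable fun ζ => ∫⁻ ξ, B i ζ ξ ∂noise := fun i =>
    (hBm i).lintegral_prod_right
  have split : ∀ f : ℕ → ℝ≥0∞, ∑ j ∈ Finset.range J, f j + ∑' i, f (J + i) = ∑' j, f j := by
    intro f
    simp_rw [add_comm J]
    exact ENNReal.summable.sum_add_tsum_nat_add'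
  -- Membership in `E` is unaffected by a coordinate below J, so restricting the average to `E`
  -- costs only the factor `noise E`.
  have hlowR : ∀ j ∈ Finset.range J, ENNReal.ofReal ((1 - 2 * δ) * riskTerm α P₀ σ ε j) * noise E ≤
      ∫⁻ ζ in E, ∫⁻ ξ, A j ζ ξ ∂noise ∂noise := by
    intro j hj
    have hjJ := Finset.mem_range.1 hj
    refine mul_measure_le_setLIntegral_coord hm σ ε ((measurable_pi_apply j).comp hest) j hEm
      (fun ζ t => tailEvent_update hjJ ζ t) fun f hf => ?_
    refine le_trans (ENNReal.ofReal_le_ofReal ?_)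
      (ofReal_le_lintegral_priorCoord_of_lt hα hP₀ hσ hε hτ hκ hκ1 hjJ (hlow j hjJ) hf)
    have := riskTerm_pos hα hP₀ hσ hε j
    gcongr
  -- From J on, `E` depends on the coordinate. The Bayes bound is therefore taken over the whole
  -- space, for the cut estimator, and the part over `Eᶜ` is handled by `hBc`.
  have hhighR : ∀ i, ENNReal.ofReal ((1 - 2 * δ) * riskTerm α P₀ σ ε (J + i)) ≤
      ∫⁻ ζ, ∫⁻ ξ, B i ζ ξ ∂noise ∂noise := by
    intro i
    have := mul_measure_le_setLIntegral_coord hm σ ε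
      (est := fun y => cutTail J R (est y) i) ((measurable_cutTail J R i).comp hest) (J + i)
      MeasurableSet.univ (fun ζ t => by simp) fun f hf =>
        ofReal_le_lintegral_priorCoord_of_le hα hP₀ hσ hε hδ hδ' (Nat.le_add_right J i) hf
    simpa using this
  have hmain : ∫⁻ ζ in E, ∑' j, ∫⁻ ξ, A j ζ ξ ∂noise ∂noise ≤
      maxRisk σ ε (besovBall α P₀) est := by
    calc ∫⁻ ζ in E, ∑' j, ∫⁻ ξ, A j ζ ξ ∂noise ∂noise
        ≤ ∫⁻ ζ in E, maxRisk σ ε (besovBall α P₀) est ∂noise := by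
          refine setLIntegral_mono measurable_const fun ζ hζ => ?_
          rw [← lintegral_tsum fun j => (hA1 j ζ).aemeasurable]
          exact le_iSup₂_of_le (X ζ)
            (priorCoord_mem_besovBall hα hP₀ hδ hδ' hτ hτδ hζ) le_rfl
      _ ≤ maxRisk σ ε (besovBall α P₀) est * 1 := by
          rw [setLIntegral_const]
          exact mul_le_mul_right prob_le_one _
      _ = _ := mul_one _
  have hAB : ∫⁻ ζ in E, ∑' i, ∫⁻ ξ, B i ζ ξ ∂noise ∂noise ≤
      ∑' i, ∫⁻ ζ in E, ∫⁻ ξ, A (J + i) ζ ξ ∂noise ∂noise := by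
    rw [← lintegral_tsum fun i => (hA2 (J + i)).aemeasurable]
    refine setLIntegral_mono (Measurable.tsum fun i => hA2 (J + i)) fun ζ hζ => ?_
    rw [← lintegral_tsum fun i => (hA1 (J + i) ζ).aemeasurable,
      ← lintegral_tsum fun i => (hB1 i ζ).aemeasurable]
    refine lintegral_mono fun ξ => tsum_cutTail_sub_sq_le ?_
    refine (tsum_priorCoord_sq_le hα hP₀ hδ' hζ le_rfl).trans (ENNReal.ofReal_le_ofReal ?_)
    nlinarith
  have hBc : ∫⁻ ζ in Eᶜ, ∑' i, ∫⁻ ξ, B i ζ ξ ∂noise ∂noise ≤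
      ENNReal.ofReal (μ * (8 + 2 * (1 + 2 * α) * (fourthMoment + 1)) * tailBound α P₀ J) := by
    refine le_trans (lintegral_mono fun ζ => ?_)
      (setLIntegral_tail_le (τ := τ) (κ := κ) (σ := σ) (ε := ε) hα hP₀ hδ hδ' hμ hμ1 hE)
    rw [← lintegral_tsum fun i => (hB1 i ζ).aemeasurable]
    calc ∫⁻ ξ, ∑' i, B i ζ ξ ∂noise ≤ ∫⁻ ξ, Q ζ ∂noise :=
          lintegral_mono fun ξ => tsum_cutTail_sub_sq_le' _ _ _
      _ = Q ζ := by simp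
  have htail : ∑' i, ENNReal.ofReal ((1 - 2 * δ) * riskTerm α P₀ σ ε (J + i)) ≤
      ∑' i, ∫⁻ ζ in E, ∫⁻ ξ, A (J + i) ζ ξ ∂noise ∂noise +
        ENNReal.ofReal (μ * (8 + 2 * (1 + 2 * α) * (fourthMoment + 1)) * tailBound α P₀ J) := by
    refine (ENNReal.tsum_le_tsum hhighR).trans ?_
    rw [← lintegral_tsum fun i => (hB2 i).aemeasurable, ← lintegral_add_compl _ hEm]
    exact add_le_add hAB hBc
  -- With γ = τ κ⁵, past the crossover each risk term is at least γ / (1 + γ) times θ_j. Hence the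
  -- tail bound at J, which is at most the tail sum of θ, is at most (1 + γ) / γ times `riskSum`.
  have hrem : ENNReal.ofReal (μ * (8 + 2 * (1 + 2 * α) * (fourthMoment + 1)) * tailBound α P₀ J) ≤
      ENNReal.ofReal (μ * (8 + 2 * (1 + 2 * α) * (fourthMoment + 1)) *
          ((1 + τ * κ ^ 5) / (τ * κ ^ 5))) * riskSum α P₀ σ ε := by
    rw [ENNReal.ofReal_mul (q := tailBound α P₀ J) (by positivity),
      ENNReal.ofReal_mul (q := (1 + τ * κ ^ 5) / (τ * κ ^ 5)) (by positivity),
      mul_assoc (ENNReal.ofReal _)]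
    gcongr
    refine (tailBound_le_tsum_ofReal hα hP₀ J).trans ?_
    rw [riskSum_eq_tsum, ← split (fun j => ENNReal.ofReal (riskTerm α P₀ σ ε j)), mul_add]
    refine le_add_left ?_
    rw [← ENNReal.tsum_mul_left]
    refine ENNReal.tsum_le_tsum fun i => ?_
    rw [← ENNReal.ofReal_mul (by positivity)]
    refine ENNReal.ofReal_le_ofReal ?_
    have hθ := thetaSq_pos hα hP₀ (J + i)
    have hv := hhigh (J + i) (Nat.le_add_right J i)
    have hγ : 0 < τ * κ ^ 5 := by positivity
    rw [riskTerm, div_mul_div_comm, le_div_iff₀ (by positivity)]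
    nlinarith [mul_le_mul_of_nonneg_left hv hθ.le]
  have hEge : ENNReal.ofReal (1 - μ ^ 2) ≤ noise E := by
    rw [ENNReal.ofReal_sub _ (sq_nonneg _), ENNReal.ofReal_one, tsub_le_iff_right]
    rw [← prob_add_prob_compl (μ := noise) hEm]
    gcongr
  calc ENNReal.ofReal ((1 - 2 * δ) * (1 - μ ^ 2)) * riskSum α P₀ σ ε
      ≤ (∑' j, ENNReal.ofReal ((1 - 2 * δ) * riskTerm α P₀ σ ε j)) * noise E := by
        rw [ENNReal.ofReal_mul hδ2, riskSum_eq_tsum]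
        simp_rw [ENNReal.ofReal_mul hδ2]
        rw [ENNReal.tsum_mul_left, mul_right_comm]
        exact mul_le_mul_right hEge _
    _ ≤ ∑ j ∈ Finset.range J, ENNReal.ofReal ((1 - 2 * δ) * riskTerm α P₀ σ ε j) * noise E +
        ∑' i, ENNReal.ofReal ((1 - 2 * δ) * riskTerm α P₀ σ ε (J + i)) := by
        rw [← split, add_mul, Finset.sum_mul]
        exact add_le_add le_rfl (mul_le_of_le_one_right' prob_le_one)
    _ ≤ ∑ j ∈ Finset.range J, ∫⁻ ζ in E, ∫⁻ ξ, A j ζ ξ ∂noise ∂noise +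
        (∑' i, ∫⁻ ζ in E, ∫⁻ ξ, A (J + i) ζ ξ ∂noise ∂noise +
        ENNReal.ofReal (μ * (8 + 2 * (1 + 2 * α) * (fourthMoment + 1)) * tailBound α P₀ J)) :=
        add_le_add (Finset.sum_le_sum hlowR) htail
    _ ≤ _ := by
        rw [← add_assoc, split (fun j => ∫⁻ ζ in E, ∫⁻ ξ, A j ζ ξ ∂noise ∂noise),
          ← lintegral_tsum fun j => (hA2 j).aemeasurable]
        exact add_le_add hmain hrem

/-- The index from which on the noise dominates the signal. -/
lemma exists_crossover (hα : 0 < α) (hP₀ : 0 < P₀)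
    (hA1 : ∃ c : ℝ, 0 < c ∧ ∀ j, c < σ j ^ 2) {j₀ : ℕ}
    (hmono : ∀ j, j₀ ≤ j → σ j ^ 2 * thetaSq α P₀ (j + 1) ≤ σ (j + 1) ^ 2 * thetaSq α P₀ j)
    {γ : ℝ} (hγ : 0 < γ) (J₁ : ℕ) :
    ∀ᶠ ε : ℝ in 𝓝[>] 0, ∃ J, J₁ ≤ J ∧ (∀ j, j < J → (ε * σ j) ^ 2 ≤ γ * thetaSq α P₀ j) ∧
      ∀ j, J ≤ j → γ * thetaSq α P₀ j ≤ (ε * σ j) ^ 2 := by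
  have hθ := fun j => thetaSq_pos hα hP₀ j
  -- For small ε the signal still dominates at these finitely many indices, which pushes the
  -- crossover past both J₁ and j₀.
  have h1 : ∀ᶠ ε : ℝ in 𝓝[>] 0, ∀ j ∈ Finset.range (max J₁ j₀),
      (ε * σ j) ^ 2 < γ * thetaSq α P₀ j := by
    rw [Filter.eventually_all_finset]
    intro j _
    have ht : Tendsto (fun ε : ℝ => (ε * σ j) ^ 2) (𝓝 0) (𝓝 ((0 * σ j) ^ 2)) :=
      Continuous.tendsto (by fun_prop) 0
    refine (ht.mono_left nhdsWithin_le_nhds).eventually_lt_const ?_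
    have := hθ j
    rw [zero_mul, zero_pow two_ne_zero]
    exact mul_pos hγ (hθ j)
  filter_upwards [h1, self_mem_nhdsWithin] with ε hε1 hε
  have hε : 0 < ε := hε
  obtain ⟨c, hc, hcσ⟩ := hA1
  -- A crossover exists because (A1) keeps the noise variance above ε² c while θ_j tends to zero.
  have hex : ∃ j, γ * thetaSq α P₀ j ≤ (ε * σ j) ^ 2 := by
    have ht : Tendsto (fun k => 2 * α * tailBound α P₀ k) atTop (𝓝 0) := by
      simpa using (tendsto_tailBound (P₀ := P₀) hα).const_mul (2 * α)
    have ht' := ht.const_mul γ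
    rw [mul_zero] at ht'
    obtain ⟨j, hj⟩ := (ht'.eventually_lt_const (show 0 < ε ^ 2 * c by positivity)).exists
    refine ⟨j, ?_⟩
    have h2 := mul_le_mul_of_nonneg_left (thetaSq_le_tailBound hα hP₀ j) hγ.le
    have h3 := mul_le_mul_of_nonneg_left (hcσ j).le (sq_nonneg ε)
    rw [mul_pow]
    linarith
  classical
  have hJ : max J₁ j₀ ≤ Nat.find hex := by
    by_contra! hlt
    exact absurd (Nat.find_spec hex) (not_le.2 (hε1 _ (Finset.mem_range.2 hlt)))
  refine ⟨Nat.find hex, (le_max_left _ _).trans hJ, fun j hj => (not_le.1 (Nat.find_min hex hj)).le,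
    fun j hj => ?_⟩
  -- Past j₀ the ratio σ_j² / θ_j does not decrease, so once the noise dominates it dominates
  -- forever.
  induction j, hj using Nat.le_induction with
  | base => exact Nat.find_spec hex
  | succ j hj ih =>
    have h2 := hmono j (((le_max_right _ _).trans hJ).trans hj)
    have h3 := hθ j
    have h4 := hθ (j + 1)
    refine le_of_mul_le_mul_right ?_ h3
    calc γ * thetaSq α P₀ (j + 1) * thetaSq α P₀ j
        = γ * thetaSq α P₀ j * thetaSq α P₀ (j + 1) := by ring
      _ ≤ (ε * σ j) ^ 2 * thetaSq α P₀ (j + 1) := by gcongr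
      _ = ε ^ 2 * (σ j ^ 2 * thetaSq α P₀ (j + 1)) := by ring
      _ ≤ ε ^ 2 * (σ (j + 1) ^ 2 * thetaSq α P₀ j) := by gcongr
      _ = _ := by ring

lemma eventually_mul_riskSum_le_minimaxRisk (hα : 0 < α) (hP₀ : 0 < P₀) (hσ : ∀ j, 0 < σ j)
    (hA1 : ∃ c : ℝ, 0 < c ∧ ∀ j, c < σ j ^ 2) {j₀ : ℕ}
    (hmono : ∀ j, j₀ ≤ j → σ j ^ 2 * thetaSq α P₀ (j + 1) ≤ σ (j + 1) ^ 2 * thetaSq α P₀ j)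
    {η : ℝ} (hη : 0 < η) (hη1 : η < 1) :
    ∀ᶠ ε : ℝ in 𝓝[>] 0, ENNReal.ofReal (1 - 3 * η) * riskSum α P₀ σ ε ≤
      minimaxRisk σ ε (besovBall α P₀) := by
  have hC := fourthMoment_nonneg
  -- Each of three losses is at most η: the variance shrinkage 2δ = η, the exceptional probability
  -- μ² ≤ η and the remainder μ K ≤ η; together they leave 1 - 3η. None of these constants depends
  -- on ε or J, so J₁ can be fixed before ε.
  set δ := η / 2 with hδ
  set τ := δ / (1 + 2 * α) with hτ
  set κ := η / (1 + 4 * fourthMoment) with hκ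
  set K := (8 + 2 * (1 + 2 * α) * (fourthMoment + 1)) * ((1 + τ * κ ^ 5) / (τ * κ ^ 5)) with hK
  have hδ0 : 0 < δ := by positivity
  have hτ0 : 0 < τ := by positivity
  have hκ0 : 0 < κ := by positivity
  have hK0 : 0 < K := by positivity
  set μ := min η (η / K) with hμ
  have hμ0 : 0 < μ := lt_min hη (by positivity)
  have hμη : μ ≤ η := min_le_left _ _
  have hμK : μ * K ≤ η := by
    rw [← le_div_iff₀ hK0]; exact min_le_right _ _
  have hprob : ∀ᶠ J in atTop, noise (tailEvent α P₀ δ J)ᶜ < ENNReal.ofReal (μ ^ 2) :=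
    (tendsto_measure_tailEvent_compl hα hP₀ hδ0 (by linarith)).eventually_lt_const
      (by rw [ENNReal.ofReal_pos]; positivity)
  obtain ⟨J₁, hJ₁⟩ := eventually_atTop.1 hprob
  filter_upwards [exists_crossover hα hP₀ hA1 hmono (show 0 < τ * κ ^ 5 by positivity) J₁,
    self_mem_nhdsWithin] with ε ⟨J, hJ, hlow, hhigh⟩ hε
  refine le_iInf₂ fun est hest => ?_
  have hκC : κ * (1 + 4 * fourthMoment) = η := by rw [hκ]; field_simp
  have key := mul_riskSum_le_maxRisk_add (ε := ε) hα hP₀ hσ hε hδ0 (by linarith) hτ0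
    (by rw [hτ]; apply le_of_eq; field_simp) hκ0 (by nlinarith) (by linarith) hlow hhigh hμ0
    (by linarith) (hJ₁ J hJ).le hest
  rw [show 1 - 3 * η = 1 - 2 * η - η by ring, ENNReal.ofReal_sub _ hη.le, ENNReal.sub_mul
    fun _ _ => riskSum_ne_top hα hP₀, tsub_le_iff_right]
  refine le_trans ?_ (key.trans ?_)
  · gcongr
    have e : 2 * δ = η := by rw [hδ]; ring
    rw [e]
    have h1 : μ ^ 2 ≤ η := by nlinarith
    have h2 := mul_le_mul_of_nonneg_left h1 (show 0 ≤ 1 - η by linarith)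
    nlinarith
  · gcongr
    rw [mul_assoc]
    exact hμK

/-- The first term of `riskSum` alone is of order ε², so the O(ε⁴) excess in the upper bound is
negligible. -/
lemma tendsto_ofReal_pow_mul_div_riskSum (hα : 0 < α) (hP₀ : 0 < P₀) (hσ : ∀ j, 0 < σ j) (S : ℝ) :
    Tendsto (fun ε : ℝ => ENNReal.ofReal (ε ^ 4 * S) / riskSum α P₀ σ ε) (𝓝[>] 0) (𝓝 0) := by
  have hθ := thetaSq_pos hα hP₀ 0
  have hσ0 := hσ 0
  have hlim : Tendsto (fun ε : ℝ => ENNReal.ofReal (ε ^ 2 * S *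
      (thetaSq α P₀ 0 + (ε * σ 0) ^ 2) / (thetaSq α P₀ 0 * σ 0 ^ 2))) (𝓝[>] 0) (𝓝 0) := by
    have : Tendsto (fun ε : ℝ => ε ^ 2 * S *
        (thetaSq α P₀ 0 + (ε * σ 0) ^ 2) / (thetaSq α P₀ 0 * σ 0 ^ 2)) (𝓝 0)
        (𝓝 (0 ^ 2 * S * (thetaSq α P₀ 0 + (0 * σ 0) ^ 2) / (thetaSq α P₀ 0 * σ 0 ^ 2))) :=
      Continuous.tendsto (by fun_prop) 0
    have h := ENNReal.tendsto_ofReal (this.mono_left (nhdsWithin_le_nhds (s := Set.Ioi 0)))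
    simpa using h
  refine tendsto_of_tendsto_of_tendsto_of_le_of_le' tendsto_const_nhds hlim
    (Eventually.of_forall fun _ => zero_le) ?_
  filter_upwards [self_mem_nhdsWithin] with ε hε
  have hε : 0 < ε := hε
  calc ENNReal.ofReal (ε ^ 4 * S) / riskSum α P₀ σ ε
      ≤ ENNReal.ofReal (ε ^ 4 * S) / ENNReal.ofReal (riskTerm α P₀ σ ε 0) :=
        ENNReal.div_le_div_left (ofReal_riskTerm_le_riskSum 0) _
    _ = _ := by
        rw [← ENNReal.ofReal_div_of_pos (riskTerm_pos hα hP₀ hσ hε 0)]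
        congr 1
        rw [riskTerm]
        field_simp

end

end SeqModel

/-! ### The asymptotic equalities. -/

open SeqModel in
theorem theorem2 (α P₀ : ℝ) (hα : 0 < α) (hP₀ : 0 < P₀)
    (σ : ℕ → ℝ) (hσ : ∀ j, 0 < σ j)
    (hA1 : ∃ c : ℝ, 0 < c ∧ ∀ j, c < σ j ^ 2)
    (hB1 : ∃ j₀ : ℕ, ∀ j : ℕ, j₀ ≤ j →
      1 < (σ (j + 1) ^ 2 * ((j : ℝ) + 2) ^ (2 * α + 1)) /
        (σ j ^ 2 * ((j : ℝ) + 1) ^ (2 * α + 1))) :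
    SeqModel.IsAsymptoticallyMinimax σ (SeqModel.besovBall α P₀)
      (fun ε => SeqModel.linearEstimator (SeqModel.weight α P₀ σ ε)) ∧
    Tendsto (fun ε : ℝ =>
        SeqModel.maxRisk σ ε (SeqModel.besovBall α P₀)
          (SeqModel.linearEstimator (SeqModel.weight α P₀ σ ε)) /
        SeqModel.riskSum α P₀ σ ε) (𝓝[>] 0) (𝓝 1) ∧
    Tendsto (fun ε : ℝ =>
        SeqModel.minimaxRisk σ ε (SeqModel.besovBall α P₀) /
        SeqModel.riskSum α P₀ σ ε) (𝓝[>] 0) (𝓝 1) := by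
  obtain ⟨j₀, hj₀⟩ := hB1
  have hmono : ∀ j, j₀ ≤ j → σ j ^ 2 * thetaSq α P₀ (j + 1) ≤ σ (j + 1) ^ 2 * thetaSq α P₀ j :=
    fun j hj => sq_mul_thetaSq_succ_le hα hP₀ hσ (hj₀ j hj)
  have hmeas : ∀ ε, Measurable (linearEstimator (weight α P₀ σ ε)) := fun ε =>
    measurable_pi_lambda _ fun j => by unfold linearEstimator; fun_prop
  have hle : ∀ ε, minimaxRisk σ ε (besovBall α P₀) ≤
      maxRisk σ ε (besovBall α P₀) (linearEstimator (weight α P₀ σ ε)) := fun ε =>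
    iInf₂_le _ (hmeas ε)
  have hD0 : ∀ ε, 0 < ε → riskSum α P₀ σ ε ≠ 0 := fun ε hε => riskSum_ne_zero hα hP₀ hσ hε
  have hDt : ∀ ε, riskSum α P₀ σ ε ≠ ∞ := fun ε => riskSum_ne_top hα hP₀
  have hlower : ∀ a : ℝ≥0∞, a < 1 → ∀ᶠ ε : ℝ in 𝓝[>] 0,
      a < minimaxRisk σ ε (besovBall α P₀) / riskSum α P₀ σ ε := by
    intro a ha
    have ha' : a ≠ ∞ := (ha.trans ENNReal.one_lt_top).ne
    have ha1 : a.toReal < 1 := by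
      simpa using (ENNReal.toReal_lt_toReal ha' ENNReal.one_ne_top).2 ha
    have ha0 : 0 ≤ a.toReal := ENNReal.toReal_nonneg
    -- With this η, 1 - 3η is the midpoint of a and 1, hence strictly above a.
    filter_upwards [eventually_mul_riskSum_le_minimaxRisk (η := (1 - a.toReal) / 6) hα hP₀ hσ hA1
      hmono (by linarith) (by linarith), self_mem_nhdsWithin] with ε h hε
    refine lt_of_lt_of_le ?_
      ((ENNReal.le_div_iff_mul_le (Or.inl (hD0 ε hε)) (Or.inl (hDt ε))).2 h)
    exact (ENNReal.lt_ofReal_iff_toReal_lt ha').2 (by linarith)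
  have hupper : ∀ b : ℝ≥0∞, 1 < b → ∀ᶠ ε : ℝ in 𝓝[>] 0,
      maxRisk σ ε (besovBall α P₀) (linearEstimator (weight α P₀ σ ε)) / riskSum α P₀ σ ε < b := by
    intro b hb
    have h := (tendsto_ofReal_pow_mul_div_riskSum hα hP₀ hσ
      (∑ j ∈ Finset.range j₀, P₀ * (σ j ^ 2 / thetaSq α P₀ j) ^ 2)).const_add 1
    rw [add_zero] at h
    filter_upwards [h.eventually_lt_const hb, self_mem_nhdsWithin] with ε h hε
    refine lt_of_le_of_lt ?_ h
    rw [← ENNReal.div_self (hD0 ε hε) (hDt ε), ENNReal.div_add_div_same]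
    exact ENNReal.div_le_div_right (maxRisk_linearEstimator_le hα hP₀ hmono) _
  have hM : Tendsto (fun ε : ℝ => maxRisk σ ε (besovBall α P₀)
      (linearEstimator (weight α P₀ σ ε)) / riskSum α P₀ σ ε) (𝓝[>] 0) (𝓝 1) :=
    tendsto_order.2 ⟨fun a ha => (hlower a ha).mono fun ε h =>
      h.trans_le (ENNReal.div_le_div_right (hle ε) _), hupper⟩
  have hm : Tendsto (fun ε : ℝ => minimaxRisk σ ε (besovBall α P₀) / riskSum α P₀ σ ε)
      (𝓝[>] 0) (𝓝 1) :=
    tendsto_order.2 ⟨hlower, fun b hb => (hupper b hb).mono fun ε h =>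
      (ENNReal.div_le_div_right (hle ε) _).trans_lt h⟩
  refine ⟨⟨fun ε _ => hmeas ε, ?_⟩, hM, hm⟩
  have h := ENNReal.Tendsto.div hM (Or.inl one_ne_zero) hm (Or.inl ENNReal.one_ne_top)
  rw [div_one] at h
  refine h.congr' ?_
  filter_upwards [self_mem_nhdsWithin] with ε hε
  rw [div_eq_mul_inv, div_eq_mul_inv _ (riskSum α P₀ σ ε)]
  exact ENNReal.mul_div_mul_right _ _ (ENNReal.inv_ne_zero.2 (hDt ε))
    (ENNReal.inv_ne_top.2 (hD0 ε hε))
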